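/- Let $\gamma\ge 1$ and $f_\gamma(u)=u^\gamma/(2\gamma)$. For each $d$ let $K(x)=e^{-d f_\gamma(|x|^2/d)}\big/\int_{\mathbb{R}^d}e^{-d f_\gamma(|z|^2/d)}\,dz$ be the normalised $\gamma$-kernel on $\mathbb{R}^d$, and let the data law be the centred Gaussian law on $\mathbb{R}^d$ with covariance matrix $C_d$ (symmetric, positive semidefinite), where $\operatorname{Tr} C_d=O(d)$ and the empirical eigenvalue distributions $\frac1d\sum_r\delta_{c_r}$ of $C_d$ converge, as $d\to\infty$ and in the sense of distributions, to a probability measure $\rho_C\neq\delta_0$ on $\mathbb{R}$. For $h,m>0$ put $$\overline g(h^2,m)=\lim_{d\to\infty}\frac1d\,\mathbb{E}_x\log\mathbb{E}_y\Big[K\Big(\frac{x-y}{h}\Big)^m\Big]-m\log h ,$$ with $x,y$ independent samples of the data law, and for $\alpha>0$ put $$\phi_{\alpha,h}(m)=\frac{1-m}{m}\,\alpha+\frac1m\,\overline g(h^2,m),\qquad D(\alpha,h)=\frac{\partial\phi_{\alpha,h}}{\partial m}(1).$$ Then the expectation over $x$ and the limit $\overline g(h^2,m)$ exist for all $h,m>0$,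 $\phi_{\alpha,h}$ is differentiable at $m=1$ for all $\alpha,h>0$, and the following hold. 1. For every $h>0$ the equations $$\frac{\hat l}{2}=\frac{1}{h^2}f_\gamma'\Big(\frac{l}{h^2}\Big),\qquad l=\int\rho_C(d\lambda)\Big(\frac{\lambda}{1+\hat l\lambda}+\frac{\lambda}{(1+\hat l\lambda)^2}\Big)$$ have a unique solution $(l^*,\hat l^*)$ with $l^*,\hat l^*\ge 0$, and for every $\alpha>0$ $$D(\alpha,h)=-\alpha+\frac12\int\rho_C(d\lambda)\Big(\log(1+\hat l^*\lambda)-\frac{\hat l^*\lambda}{(1+\hat l^*\lambda)^2}\Big),$$ the integral being convergent. 2. For every $\alpha>0$ the equation $D(\alpha,h)=0$ has a unique solution $h=h_G(\alpha)>0$; moreover $D(\alpha,h)>0$ for $0<h<h_G(\alpha)$ and $D(\alpha,h)<0$ for $h>h_G(\alpha)$. 3. For the Gaussian kernel ($\gamma=1$) one has $\hat l^*=1/h^2$, and $h_G(\alpha)$ is the unique $h>0$ with $$\alpha=\frac12\int\rho_C(d\lambda)\Big(\log\big(1+\lambda/h^2\big)-\frac{\lambda/h^2}{(1+\lambda/h^2)^2}\Big).$$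 -/

import Mathlib

open MeasureTheory ProbabilityTheory Filter Topology
open scoped ContDiff

noncomputable section

namespace GaussKDE

/-- The function `f_γ(u) = u ^ γ / (2 γ)`. -/
def rate (γ u : ℝ) : ℝ := u ^ γ / (2 * γ)

/-- The `γ`-kernel on `ℝᵈ` with the Euclidean norm, normalised so that its integral is one:
`K_γ(x) = exp (d (c - f_γ (|x|² / d)))` with `exp (- d c) = ∫ exp (- d f_γ (|x|² / d)) dx`. -/
def kernel (γ : ℝ) (d : ℕ) (x : EuclideanSpace ℝ (Fin d)) : ℝ :=
  Real.exp (-(d * rate γ (‖x‖ ^ 2 / d))) /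
    ∫ z : EuclideanSpace ℝ (Fin d), Real.exp (-(d * rate γ (‖z‖ ^ 2 / d)))

/-- The centred Gaussian law on `ℝᵈ` with covariance matrix `C`. -/
def dataLaw {d : ℕ} (C : Matrix (Fin d) (Fin d) ℝ) : Measure (EuclideanSpace ℝ (Fin d)) :=
  multivariateGaussian 0 C

/-- `log 𝔼_y [K((x - y) / h) ^ m]`, as a function of the point `x`. -/
def logMoment (γ : ℝ) {d : ℕ} (C : Matrix (Fin d) (Fin d) ℝ) (h m : ℝ)
    (x : EuclideanSpace ℝ (Fin d)) : ℝ :=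
  Real.log (∫ y, kernel γ d (h⁻¹ • (x - y)) ^ m ∂(dataLaw C))

/-- `(1/d) 𝔼_x log 𝔼_y [K((x - y) / h) ^ m] - m log h` in dimension `d`. -/
def gMean (γ : ℝ) {d : ℕ} (C : Matrix (Fin d) (Fin d) ℝ) (h m : ℝ) : ℝ :=
  (1 / d) * (∫ x, logMoment γ C h m x ∂(dataLaw C)) - m * Real.log h

/-- The large-`d` limit of `gMean` along a sequence of covariance matrices. -/
def gBar (γ : ℝ) (C : (d : ℕ) → Matrix (Fin d) (Fin d) ℝ) (h m : ℝ) : ℝ :=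
  limUnder atTop fun d : ℕ => gMean γ (C d) h m

/-- The replica free entropy `φ_{α,h}(m)`. -/
def replicaFreeEntropy (γ : ℝ) (C : (d : ℕ) → Matrix (Fin d) (Fin d) ℝ) (α h m : ℝ) : ℝ :=
  (1 - m) / m * α + 1 / m * gBar γ C h m

/-- `D(α,h)`: the derivative of the replica free entropy with respect to `m` at `m = 1`. -/
def glassD (γ : ℝ) (C : (d : ℕ) → Matrix (Fin d) (Fin d) ℝ) (α h : ℝ) : ℝ :=
  deriv (fun m => replicaFreeEntropy γ C α h m) 1

/-- The normalised eigenvalue counting measures `(1/d) ∑_r δ_{c_r}` of the positive semidefinite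
matrices `C d` converge to `ρ` in the sense of distributions. -/
def SpectrumTendsto (C : (d : ℕ) → Matrix (Fin d) (Fin d) ℝ) (hC : ∀ d, (C d).PosSemidef)
    (ρ : Measure ℝ) : Prop :=
  ∀ φ : ℝ → ℝ, ContDiff ℝ ∞ φ → HasCompactSupport φ →
    Tendsto (fun d : ℕ => (1 / (d : ℝ)) * ∑ r, φ ((hC d).isHermitian.eigenvalues r)) atTop
      (𝓝 (∫ t, φ t ∂ρ))

/-- `(l, lhat)` solves the two stationarity equations at the parameters `h`, `m`. -/
structure IsStationary (γ : ℝ) (ρ : Measure ℝ) (h m l lhat : ℝ) : Prop where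
  l_nonneg : 0 ≤ l
  lhat_nonneg : 0 ≤ lhat
  eq_lhat : lhat / 2 = m / h ^ 2 * deriv (rate γ) (l / h ^ 2)
  eq_l : l = ∫ t, (t / (1 + lhat * t) + t / (1 + lhat * t) ^ 2) ∂ρ

/-- `log (1 + s) - s / (1 + s) ^ 2`. -/
def integrand (s : ℝ) : ℝ := Real.log (1 + s) - s / (1 + s) ^ 2

end GaussKDE

end

namespace GaussKDE

/-! ### Tilting the standard Gaussian law by a quadratic factor -/

/-! After diagonalising `C d`, the quantity to control is `log 𝔼_y exp (-d Φ(r))`, where `r = (1/d)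
∑ c_i (x_i - y_i)²` is a weighted squared distance between standard Gaussian vectors and `Φ(r) = m
f_γ(r / h²)` is convex. For a slope `s > 0`, the weight `exp (-d s r / 2)` factorises over
coordinates, so its Gaussian integral is explicit (`integral_tilt`).

Two bounds meet. From above, `Φ` is replaced by its tangent line of slope `s / 2` at `l`
(`logLaplace_le`). From below, the law of `y` is tilted by the same weight and Jensen's inequality
is applied under the tilted law (`le_logLaplace`). There `r` is a mean of `d` independent terms with
variance of order `1/d`, so it concentrates at `tiltedMean`, which tends to `meanFun ρ s`. The
bounds agree in the limit when `l = meanFun ρ s` and `s / 2 = Φ'(l)`, which are the stationarity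
equations. The limit is `freeEntropy`, up to the Gamma-function asymptotics of the kernel
normalisation (`exists_tendsto_log_kernelNorm`), which add only a term linear in `m`. Bounded traces
and weak spectral convergence suffice because every spectral statistic involved grows sublinearly
(`tendsto_of_sublinear`).

The equations reduce to `s = κ · meanFun(s) ^ (γ - 1)` with `κ = m / h ^ (2γ)`. Since `meanFun`
decreases, the root exists, is unique, and is continuous and strictly increasing in `κ`. By an
envelope argument, `freeEntropy` has derivative `-f_γ(l / h²)` in `m`, the movement of the root
contributing nothing (`hasDerivAt_freeEntropy`). Hence `D(α,h) = -α + gapFun(s)` at `m = 1`. As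
`gapFun` increases strictly and continuously from `0` to `∞` while `s` decreases strictly in `h`,
the sign of `D` changes exactly once (`exists_threshold`). -/

theorem pi_withDensity_ofReal {ι : Type*} [Fintype ι] {X : ι → Type*}
    [∀ i, MeasurableSpace (X i)] (μ : ∀ i, Measure (X i)) [∀ i, IsProbabilityMeasure (μ i)]
    (g : ∀ i, X i → ℝ) (hg0 : ∀ i x, 0 ≤ g i x) (hgi : ∀ i, Integrable (g i) (μ i)) :
    Measure.pi (fun i => (μ i).withDensity fun x => ENNReal.ofReal (g i x)) =
      (Measure.pi μ).withDensity fun x => ENNReal.ofReal (∏ i, g i (x i)) := by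
  refine Measure.pi_eq fun s hs => ?_
  have hprod : ∀ x : ∀ i, X i, 0 ≤ ∏ i, g i (x i) := fun x =>
    Finset.prod_nonneg fun i _ => hg0 i _
  rw [withDensity_apply _ (MeasurableSet.univ_pi hs), Measure.restrict_pi_pi,
    ← ofReal_integral_eq_lintegral_ofReal
      (Integrable.fintype_prod_dep fun i => (hgi i).mono_measure Measure.restrict_le_self)
      (Eventually.of_forall hprod),
    integral_fintype_prod_eq_prod, ENNReal.ofReal_prod_of_nonneg]
  · refine Finset.prod_congr rfl fun i _ => ?_
    rw [withDensity_apply _ (hs i),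
      ofReal_integral_eq_lintegral_ofReal ((hgi i).mono_measure Measure.restrict_le_self)
        (Eventually.of_forall (hg0 i))]
  · exact fun i _ => integral_nonneg (hg0 i)

/-- `𝔼 exp (- a (x - η)² / 2)` for a standard Gaussian `η`. -/
noncomputable def tiltNorm (a x : ℝ) : ℝ :=
  (Real.sqrt (1 + a))⁻¹ * Real.exp (-(a * x ^ 2 / (2 * (1 + a))))

theorem tiltNorm_pos {a : ℝ} (ha : 0 ≤ a) (x : ℝ) : 0 < tiltNorm a x := by
  have : 0 < 1 + a := by linarith
  unfold tiltNorm
  positivity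

theorem log_tiltNorm {a : ℝ} (ha : 0 ≤ a) (x : ℝ) :
    Real.log (tiltNorm a x) = -(1 / 2) * Real.log (1 + a) - a / (2 * (1 + a)) * x ^ 2 := by
  have : 0 < 1 + a := by linarith
  rw [tiltNorm, Real.log_mul (by positivity) (by positivity), Real.log_exp, Real.log_inv,
    Real.log_sqrt this.le]
  ring

/-- Completing the square in `y`: the precision rises from `1` to `1 + a`, and `tiltNorm` is the
total mass of the weight. -/
theorem gaussianReal_withDensity_tilt {a : ℝ} (ha : 0 ≤ a) (x : ℝ) :
    (gaussianReal 0 1).withDensity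
        (fun y => ENNReal.ofReal ((tiltNorm a x)⁻¹ * Real.exp (-(a * (x - y) ^ 2 / 2)))) =
      gaussianReal (a * x / (1 + a)) (Real.toNNReal (1 / (1 + a))) := by
  have h1 : 0 < 1 + a := by linarith
  have hv : Real.toNNReal (1 / (1 + a)) ≠ 0 := by
    rw [ne_eq, Real.toNNReal_eq_zero, not_le]; positivity
  rw [gaussianReal_of_var_ne_zero _ one_ne_zero, gaussianReal_of_var_ne_zero _ hv,
    ← withDensity_mul _ (measurable_gaussianPDF _ _) (by fun_prop)]
  congr 1
  funext y
  rw [Pi.mul_apply, gaussianPDF, gaussianPDF, ← ENNReal.ofReal_mul (gaussianPDFReal_nonneg _ _ _)]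
  congr 1
  rw [gaussianPDFReal, gaussianPDFReal, Real.coe_toNNReal _ (by positivity), tiltNorm]
  simp only [NNReal.coe_one, mul_one, sub_zero]
  rw [show 2 * Real.pi * (1 / (1 + a)) = 2 * Real.pi / (1 + a) by ring,
    Real.sqrt_div (by positivity), mul_inv, inv_inv, ← Real.exp_neg, inv_div, neg_neg]
  have key : Real.exp (-y ^ 2 / 2) * (Real.exp (a * x ^ 2 / (2 * (1 + a))) *
      Real.exp (-(a * (x - y) ^ 2 / 2))) =
      Real.exp (-(y - a * x / (1 + a)) ^ 2 / (2 * (1 / (1 + a)))) := by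
    rw [← Real.exp_add, ← Real.exp_add]
    congr 1
    field_simp
    ring
  rw [← key]
  ring

theorem gaussianReal_map_affine {a : ℝ} (ha : 0 ≤ a) (b : ℝ) :
    (gaussianReal 0 1).map (fun y => b + (Real.sqrt (1 + a))⁻¹ * y) =
      gaussianReal b (Real.toNNReal (1 / (1 + a))) := by
  have h1 : 0 < 1 + a := by linarith
  have : (fun y => b + (Real.sqrt (1 + a))⁻¹ * y) =
      (fun y => b + y) ∘ fun y => (Real.sqrt (1 + a))⁻¹ * y := rfl
  rw [this, ← Measure.map_map (by fun_prop) (by fun_prop), gaussianReal_map_const_mul,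
    gaussianReal_map_const_add]
  congr 1
  · ring
  · ext
    rw [Real.coe_toNNReal _ (by positivity)]
    simp [inv_pow, Real.sq_sqrt h1.le]

variable {d : ℕ}

/-- The standard Gaussian law on `Fin d → ℝ`. -/
noncomputable def stdPi (d : ℕ) : Measure (Fin d → ℝ) := Measure.pi fun _ => gaussianReal 0 1

instance : IsProbabilityMeasure (stdPi d) := by unfold stdPi; infer_instance

/-- The normalised weight is a product density, and the tilted law is again Gaussian, hence an
affine image of the standard one. Weighted integrals become plain ones. -/
theorem integral_tilt (a : Fin d → ℝ) (ha : ∀ i, 0 ≤ a i) (x : Fin d → ℝ)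
    {G : (Fin d → ℝ) → ℝ} (hG : Measurable G) :
    ∫ y, Real.exp (-∑ i, a i * (x i - y i) ^ 2 / 2) * G y ∂(stdPi d) =
      (∏ i, tiltNorm (a i) (x i)) *
        ∫ y, G (fun i => a i * x i / (1 + a i) + (Real.sqrt (1 + a i))⁻¹ * y i) ∂(stdPi d) := by
  set g : Fin d → ℝ → ℝ :=
    fun i y => (tiltNorm (a i) (x i))⁻¹ * Real.exp (-(a i * (x i - y) ^ 2 / 2)) with hg
  have hg0 : ∀ i y, 0 ≤ g i y := fun i y =>
    mul_nonneg (inv_nonneg.2 (tiltNorm_pos (ha i) _).le) (Real.exp_pos _).le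
  have hgi : ∀ i, Integrable (g i) (gaussianReal 0 1) := fun i => by
    refine Integrable.const_mul ?_ _
    refine Integrable.of_bound (C := 1) (by fun_prop) (Eventually.of_forall fun y => ?_)
    rw [Real.norm_eq_abs, abs_of_pos (Real.exp_pos _), Real.exp_le_one_iff]
    have := ha i
    have : 0 ≤ a i * (x i - y) ^ 2 / 2 := by positivity
    linarith
  have key : (stdPi d).map
      (fun y i => a i * x i / (1 + a i) + (Real.sqrt (1 + a i))⁻¹ * y i) =
      (stdPi d).withDensity fun y => ENNReal.ofReal (∏ i, g i (y i)) := by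
    rw [stdPi, ← pi_withDensity_ofReal _ g hg0 hgi, Measure.pi_map_pi (f := fun i y =>
      a i * x i / (1 + a i) + (Real.sqrt (1 + a i))⁻¹ * y) (fun i => by fun_prop)]
    congr 1
    funext i
    rw [gaussianReal_withDensity_tilt (ha i), gaussianReal_map_affine (ha i)]
  have hmap := integral_map (μ := stdPi d) (f := G)
    (φ := fun y i => a i * x i / (1 + a i) + (Real.sqrt (1 + a i))⁻¹ * y i)
    (Measurable.aemeasurable (by fun_prop)) hG.aestronglyMeasurable
  rw [← hmap, key,
    integral_withDensity_eq_integral_toReal_smul (by fun_prop)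
      (Eventually.of_forall fun _ => ENNReal.ofReal_lt_top), ← integral_const_mul]
  refine integral_congr_ae (Eventually.of_forall fun y => ?_)
  have hpos : 0 < ∏ i, tiltNorm (a i) (x i) :=
    Finset.prod_pos fun i _ => tiltNorm_pos (ha i) _
  simp only [smul_eq_mul]
  rw [ENNReal.toReal_ofReal (Finset.prod_nonneg fun i _ => hg0 i _), hg]
  simp only
  rw [Finset.prod_mul_distrib, Finset.prod_inv_distrib, ← Real.exp_sum, Finset.sum_neg_distrib]
  field_simp

end GaussKDE

namespace GaussKDE

variable {d : ℕ}

/-! ### Two-sided bounds on the log-Laplace functional -/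

/-- The normalised squared distance `(1/d) ∑ c_i (x_i - y_i)²`. -/
noncomputable def sqDist (c x y : Fin d → ℝ) : ℝ := (∑ i, c i * (x i - y i) ^ 2) / d

/-- The normalised squared distance after the tilting of `y`. -/
noncomputable def tiltedSqDist (s : ℝ) (c x y : Fin d → ℝ) : ℝ :=
  (∑ i, c i * (x i / (1 + s * c i) - (Real.sqrt (1 + s * c i))⁻¹ * y i) ^ 2) / d

theorem sqDist_nonneg {c : Fin d → ℝ} (hc : ∀ i, 0 ≤ c i) (x y : Fin d → ℝ) :
    0 ≤ sqDist c x y :=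
  div_nonneg (Finset.sum_nonneg fun i _ => mul_nonneg (hc i) (sq_nonneg _)) (Nat.cast_nonneg d)

theorem tiltedSqDist_nonneg {c : Fin d → ℝ} (hc : ∀ i, 0 ≤ c i) (s : ℝ) (x y : Fin d → ℝ) :
    0 ≤ tiltedSqDist s c x y :=
  div_nonneg (Finset.sum_nonneg fun i _ => mul_nonneg (hc i) (sq_nonneg _)) (Nat.cast_nonneg d)

@[fun_prop]
theorem measurable_sqDist (c : Fin d → ℝ) :
    Measurable fun p : (Fin d → ℝ) × (Fin d → ℝ) => sqDist c p.1 p.2 := by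
  unfold sqDist; fun_prop

@[fun_prop]
theorem measurable_tiltedSqDist (s : ℝ) (c : Fin d → ℝ) :
    Measurable fun p : (Fin d → ℝ) × (Fin d → ℝ) => tiltedSqDist s c p.1 p.2 := by
  unfold tiltedSqDist; fun_prop

theorem measurable_sqDist_right (c x : Fin d → ℝ) : Measurable fun y => sqDist c x y := by
  unfold sqDist; fun_prop

theorem measurable_tiltedSqDist_right (s : ℝ) (c x : Fin d → ℝ) :
    Measurable fun y => tiltedSqDist s c x y := by
  unfold tiltedSqDist; fun_prop

theorem sqDist_tilt {s : ℝ} (hs : 0 ≤ s) {c : Fin d → ℝ} (hc : ∀ i, 0 ≤ c i)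
    (x y : Fin d → ℝ) :
    sqDist c x (fun i => s * c i * x i / (1 + s * c i) + (Real.sqrt (1 + s * c i))⁻¹ * y i) =
      tiltedSqDist s c x y := by
  unfold sqDist tiltedSqDist
  congr 1
  refine Finset.sum_congr rfl fun i _ => ?_
  have : 0 < 1 + s * c i := by have := mul_nonneg hs (hc i); linarith
  congr 2
  field_simp
  ring

/-- `log 𝔼_y exp (- d Φ ((1/d) ∑ c_i (x_i - y_i)²))` for a standard Gaussian vector `y`. -/
noncomputable def logLaplace (Φ : ℝ → ℝ) (c x : Fin d → ℝ) : ℝ :=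
  Real.log (∫ y, Real.exp (-(d * Φ (sqDist c x y))) ∂(stdPi d))

theorem integrable_exp_neg_sqDist {Φ : ℝ → ℝ} (hΦm : Measurable Φ) (hΦ0 : ∀ r, 0 ≤ r → 0 ≤ Φ r)
    {c : Fin d → ℝ} (hc : ∀ i, 0 ≤ c i) (x : Fin d → ℝ) :
    Integrable (fun y => Real.exp (-(d * Φ (sqDist c x y)))) (stdPi d) := by
  have := measurable_sqDist_right c x
  refine Integrable.of_bound (C := 1) (Measurable.aestronglyMeasurable (by fun_prop))
      (Eventually.of_forall fun y => ?_)
  rw [Real.norm_eq_abs, abs_of_pos (Real.exp_pos _), Real.exp_le_one_iff]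
  have := hΦ0 _ (sqDist_nonneg hc x y)
  have : 0 ≤ (d : ℝ) * Φ (sqDist c x y) := by positivity
  linarith

theorem measurable_logLaplace {Φ : ℝ → ℝ} (hΦm : Measurable Φ) (c : Fin d → ℝ) :
    Measurable (logLaplace Φ c) := by
  unfold logLaplace
  refine Real.measurable_log.comp (StronglyMeasurable.measurable ?_)
  refine StronglyMeasurable.integral_prod_right (f := fun x y =>
    Real.exp (-(d * Φ (sqDist c x y)))) (Measurable.stronglyMeasurable ?_)
  unfold Function.uncurry
  fun_prop

theorem dim_mul_sqDist (hd : d ≠ 0) (c x y : Fin d → ℝ) :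
    (d : ℝ) * sqDist c x y = ∑ i, c i * (x i - y i) ^ 2 := by
  have : (d : ℝ) ≠ 0 := by exact_mod_cast hd
  unfold sqDist
  field_simp

theorem exp_neg_sum_eq (hd : d ≠ 0) (s : ℝ) (c x y : Fin d → ℝ) :
    Real.exp (-∑ i, s * c i * (x i - y i) ^ 2 / 2) = Real.exp (-(s * d * sqDist c x y / 2)) := by
  rw [mul_assoc, dim_mul_sqDist hd, Finset.mul_sum, Finset.sum_div]
  simp only [mul_assoc]

theorem log_prod_tiltNorm {s : ℝ} (hs : 0 ≤ s) {c : Fin d → ℝ} (hc : ∀ i, 0 ≤ c i)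
    (x : Fin d → ℝ) :
    Real.log (∏ i, tiltNorm (s * c i) (x i)) = ∑ i, Real.log (tiltNorm (s * c i) (x i)) :=
  Real.log_prod fun i _ => (tiltNorm_pos (mul_nonneg hs (hc i)) _).ne'

/-- Bounding `Φ` below by an affine function turns the integrand into a constant times the quadratic
weight, whose integral is the product of the `tiltNorm`. -/
theorem logLaplace_le (hd : d ≠ 0) {Φ : ℝ → ℝ} (hΦm : Measurable Φ)
    (hΦ0 : ∀ r, 0 ≤ r → 0 ≤ Φ r) {s l : ℝ} (hs : 0 ≤ s)
    (htan : ∀ r, 0 ≤ r → Φ l + s / 2 * (r - l) ≤ Φ r)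
    {c : Fin d → ℝ} (hc : ∀ i, 0 ≤ c i) (x : Fin d → ℝ) :
    logLaplace Φ c x ≤ d * (-Φ l + s * l / 2) + ∑ i, Real.log (tiltNorm (s * c i) (x i)) := by
  have hint := integrable_exp_neg_sqDist hΦm hΦ0 hc x
  have hpos : 0 < ∏ i, tiltNorm (s * c i) (x i) :=
    Finset.prod_pos fun i _ => tiltNorm_pos (mul_nonneg hs (hc i)) _
  have hm := measurable_sqDist_right c x
  rw [← log_prod_tiltNorm hs hc, ← Real.log_exp (d * (-Φ l + s * l / 2)),
    ← Real.log_mul (Real.exp_pos _).ne' hpos.ne']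
  refine Real.log_le_log (integral_exp_pos hint) ?_
  have h1 := integral_tilt (fun i => s * c i) (fun i => mul_nonneg hs (hc i)) x
    (G := fun _ => 1) measurable_const
  simp only [mul_one, integral_const, probReal_univ, smul_eq_mul] at h1
  rw [← h1, ← integral_const_mul]
  refine integral_mono hint ?_ fun y => ?_
  · refine Integrable.const_mul ?_ _
    refine Integrable.of_bound (C := 1) (Measurable.aestronglyMeasurable (by fun_prop))
      (Eventually.of_forall fun y => ?_)
    rw [Real.norm_eq_abs, abs_of_pos (Real.exp_pos _), Real.exp_le_one_iff, neg_nonpos]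
    exact Finset.sum_nonneg fun i _ =>
      div_nonneg (mul_nonneg (mul_nonneg hs (hc i)) (sq_nonneg _)) zero_le_two
  · simp only
    rw [exp_neg_sum_eq hd, ← Real.exp_add, Real.exp_le_exp]
    have h2 := mul_le_mul_of_nonneg_left (htan _ (sqDist_nonneg hc x y)) (Nat.cast_nonneg (α := ℝ) d)
    linarith

/-- Tilting is exact; what remains is `𝔼 exp V` under the tilted law with `V = d (s r / 2 - Φ(r))`,
and Jensen's inequality for `exp` replaces it by `exp 𝔼 V`. -/
theorem le_logLaplace (hd : d ≠ 0) {Φ : ℝ → ℝ} (hΦm : Measurable Φ)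
    {s l : ℝ} (hs : 0 ≤ s)
    (htan : ∀ r, 0 ≤ r → Φ l + s / 2 * (r - l) ≤ Φ r)
    {c : Fin d → ℝ} (hc : ∀ i, 0 ≤ c i) (x : Fin d → ℝ)
    (h1 : Integrable (fun y => tiltedSqDist s c x y) (stdPi d))
    (h2 : Integrable (fun y => Φ (tiltedSqDist s c x y)) (stdPi d)) :
    ∑ i, Real.log (tiltNorm (s * c i) (x i)) +
      d * ∫ y, (s / 2 * tiltedSqDist s c x y - Φ (tiltedSqDist s c x y)) ∂(stdPi d) ≤
      logLaplace Φ c x := by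
  have hpos : 0 < ∏ i, tiltNorm (s * c i) (x i) :=
    Finset.prod_pos fun i _ => tiltNorm_pos (mul_nonneg hs (hc i)) _
  have hm := measurable_sqDist_right c x
  have hm' := measurable_tiltedSqDist_right s c x
  set V : ℝ → ℝ := fun r => d * (s / 2 * r - Φ r) with hV
  have hVm : Measurable V := by fun_prop
  have hVi : Integrable (fun y => V (tiltedSqDist s c x y)) (stdPi d) :=
    ((h1.const_mul (s / 2)).sub h2).const_mul _
  -- The tangent inequality serves here only to bound `V` above, so that `exp V` is bounded.
  have heVi : Integrable (fun y => Real.exp (V (tiltedSqDist s c x y))) (stdPi d) := by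
    refine Integrable.of_bound (C := Real.exp (d * (s / 2 * l - Φ l)))
      (Measurable.aestronglyMeasurable (by fun_prop))
      (Eventually.of_forall fun y => ?_)
    rw [Real.norm_eq_abs, abs_of_pos (Real.exp_pos _), Real.exp_le_exp]
    refine mul_le_mul_of_nonneg_left ?_ (Nat.cast_nonneg _)
    linarith [htan _ (tiltedSqDist_nonneg hc s x y)]
  have key : ∫ y, Real.exp (-(d * Φ (sqDist c x y))) ∂(stdPi d) =
      (∏ i, tiltNorm (s * c i) (x i)) *
        ∫ y, Real.exp (V (tiltedSqDist s c x y)) ∂(stdPi d) := by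
    have h3 := integral_tilt (fun i => s * c i) (fun i => mul_nonneg hs (hc i)) x
      (G := fun y => Real.exp (V (sqDist c x y))) (by fun_prop)
    simp only [sqDist_tilt hs hc] at h3
    rw [← h3]
    refine integral_congr_ae (Eventually.of_forall fun y => ?_)
    simp only
    rw [exp_neg_sum_eq hd, ← Real.exp_add]
    congr 1
    simp only [hV]
    ring
  have hJ : Real.exp (∫ y, V (tiltedSqDist s c x y) ∂(stdPi d)) ≤
      ∫ y, Real.exp (V (tiltedSqDist s c x y)) ∂(stdPi d) :=
    convexOn_exp.map_integral_le Real.continuous_exp.continuousOn isClosed_univ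
      (Eventually.of_forall fun _ => Set.mem_univ _) hVi heVi
  rw [logLaplace, key, Real.log_mul hpos.ne' (integral_exp_pos heVi).ne',
    log_prod_tiltNorm hs hc, ← integral_const_mul]
  gcongr
  rwa [Real.le_log_iff_exp_le (integral_exp_pos heVi)]

end GaussKDE

namespace GaussKDE

variable {d : ℕ}

/-! ### Moments of the tilted squared distance -/

/-- The law of a pair of independent standard Gaussian variables. -/
noncomputable def stdPair : Measure (ℝ × ℝ) := (gaussianReal 0 1).prod (gaussianReal 0 1)

instance : IsProbabilityMeasure stdPair := by unfold stdPair; infer_instance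

/-- The moments `𝔼 (|ξ| + |η|) ^ n` for a pair of independent standard Gaussian variables. -/
noncomputable def pairMoment (n : ℕ) : ℝ := ∫ p, (|p.1| + |p.2|) ^ n ∂stdPair

theorem memLp_pair (n : ℕ) : MemLp (fun p : ℝ × ℝ => |p.1| + |p.2|) n stdPair := by
  have h := memLp_id_gaussianReal' (μ := 0) (v := 1) (n : ENNReal) (by simp)
  exact (h.comp_fst (ν := gaussianReal 0 1)).norm.add (h.comp_snd (μ := gaussianReal 0 1)).norm

theorem integrable_pair_pow (n : ℕ) :
    Integrable (fun p : ℝ × ℝ => (|p.1| + |p.2|) ^ n) stdPair := by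
  refine (memLp_pair n).integrable_norm_pow'.congr (Eventually.of_forall fun p => ?_)
  simp only [Real.norm_eq_abs]
  rw [abs_of_nonneg (by positivity)]

/-- One summand of the tilted squared distance. -/
noncomputable def tiltedSq (s c : ℝ) (p : ℝ × ℝ) : ℝ :=
  c * (p.1 / (1 + s * c) - (Real.sqrt (1 + s * c))⁻¹ * p.2) ^ 2

@[fun_prop]
theorem measurable_tiltedSq (s c : ℝ) : Measurable (tiltedSq s c) := by
  unfold tiltedSq; fun_prop

theorem tiltedSq_nonneg (s : ℝ) {c : ℝ} (hc : 0 ≤ c) (p : ℝ × ℝ) : 0 ≤ tiltedSq s c p :=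
  mul_nonneg hc (sq_nonneg _)

/-- The bound is uniform in `c`, since `c / (1 + s c) ≤ 1 / s`. Tilting thus tames large
eigenvalues, and no bound on the spectral radius is needed. -/
theorem tiltedSq_le {s c : ℝ} (hs : 0 < s) (hc : 0 ≤ c) (p : ℝ × ℝ) :
    tiltedSq s c p ≤ s⁻¹ * (|p.1| + |p.2|) ^ 2 := by
  have h0 : 0 ≤ s * c := by positivity
  have h1 : 1 ≤ 1 + s * c := by linarith
  set k := (Real.sqrt (1 + s * c))⁻¹ with hk
  have hsq1 : 1 ≤ Real.sqrt (1 + s * c) := Real.one_le_sqrt.2 h1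
  have hk0 : 0 < k := by positivity
  have hk1 : k ≤ 1 := inv_le_one_of_one_le₀ hsq1
  have hkk : k ^ 2 = 1 / (1 + s * c) := by
    rw [hk, inv_pow, Real.sq_sqrt (by positivity), one_div]
  have hck : c * k ^ 2 ≤ s⁻¹ := by
    rw [hkk, mul_one_div, inv_eq_one_div, div_le_div_iff₀ (by positivity) hs]
    nlinarith
  have hw : |p.1 / (1 + s * c) - k * p.2| ≤ k * (|p.1| + |p.2|) := by
    have : p.1 / (1 + s * c) = k ^ 2 * p.1 := by rw [hkk]; ring
    rw [this]
    calc |k ^ 2 * p.1 - k * p.2| ≤ |k ^ 2 * p.1| + |k * p.2| := abs_sub _ _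
      _ = k ^ 2 * |p.1| + k * |p.2| := by
          rw [abs_mul, abs_mul, abs_of_pos hk0, abs_of_pos (pow_pos hk0 2)]
      _ ≤ k * |p.1| + k * |p.2| := by
          gcongr
          nlinarith
      _ = _ := by ring
  calc tiltedSq s c p = c * |p.1 / (1 + s * c) - k * p.2| ^ 2 := by rw [sq_abs]; rfl
    _ ≤ c * (k * (|p.1| + |p.2|)) ^ 2 := by gcongr
    _ = c * k ^ 2 * (|p.1| + |p.2|) ^ 2 := by ring
    _ ≤ _ := by gcongr

theorem tiltedSq_pow_le {s c : ℝ} (hs : 0 < s) (hc : 0 ≤ c) (n : ℕ) (p : ℝ × ℝ) :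
    tiltedSq s c p ^ n ≤ (s⁻¹) ^ n * (|p.1| + |p.2|) ^ (2 * n) := by
  rw [pow_mul, ← mul_pow]
  exact pow_le_pow_left₀ (tiltedSq_nonneg s hc p) (tiltedSq_le hs hc p) n

theorem integrable_tiltedSq_pow {s c : ℝ} (hs : 0 < s) (hc : 0 ≤ c) (n : ℕ) :
    Integrable (fun p => tiltedSq s c p ^ n) stdPair := by
  refine ((integrable_pair_pow (2 * n)).const_mul ((s⁻¹) ^ n)).mono'
    (Measurable.aestronglyMeasurable (by fun_prop)) (Eventually.of_forall fun p => ?_)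
  rw [Real.norm_eq_abs, abs_of_nonneg (pow_nonneg (tiltedSq_nonneg s hc p) n)]
  exact tiltedSq_pow_le hs hc n p

theorem integral_tiltedSq_pow_le {s c : ℝ} (hs : 0 < s) (hc : 0 ≤ c) (n : ℕ) :
    ∫ p, tiltedSq s c p ^ n ∂stdPair ≤ (s⁻¹) ^ n * pairMoment (2 * n) := by
  rw [pairMoment, ← integral_const_mul]
  exact integral_mono (integrable_tiltedSq_pow hs hc n) ((integrable_pair_pow _).const_mul _)
    (tiltedSq_pow_le hs hc n)

theorem integral_sq_gaussianReal : ∫ x, x ^ 2 ∂(gaussianReal 0 1) = 1 := by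
  have h := variance_fun_id_gaussianReal (μ := 0) (v := 1)
  rw [variance_eq_integral (by fun_prop)] at h
  simpa using h

theorem integrable_sq_gaussianReal : Integrable (fun x : ℝ => x ^ 2) (gaussianReal 0 1) :=
  (memLp_id_gaussianReal' (μ := 0) (v := 1) 2 (by simp)).integrable_sq

/-- The cross term has mean zero. The first term on the right is the variance of the tilted `y`, the
second comes from `x`; together they give the integrand of the equation for `l`. -/
theorem integral_tiltedSq {s c : ℝ} (hs : 0 ≤ s) (hc : 0 ≤ c) :
    ∫ p, tiltedSq s c p ∂stdPair = c / (1 + s * c) + c / (1 + s * c) ^ 2 := by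
  have h0 : 0 < 1 + s * c := by positivity
  set k := (Real.sqrt (1 + s * c))⁻¹ with hk
  have hkk : k ^ 2 = 1 / (1 + s * c) := by
    rw [hk, inv_pow, Real.sq_sqrt h0.le, one_div]
  have hid : Integrable (fun x : ℝ => x) (gaussianReal 0 1) := IsGaussian.integrable_id
  have i1 : Integrable (fun p : ℝ × ℝ => c / (1 + s * c) ^ 2 * p.1 ^ 2) stdPair :=
    (integrable_sq_gaussianReal.comp_fst _).const_mul _
  have i2 : Integrable (fun p : ℝ × ℝ => 2 * c * k / (1 + s * c) * (p.1 * p.2)) stdPair :=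
    (hid.mul_prod hid).const_mul _
  have i3 : Integrable (fun p : ℝ × ℝ => c / (1 + s * c) * p.2 ^ 2) stdPair :=
    (integrable_sq_gaussianReal.comp_snd _).const_mul _
  have : tiltedSq s c = fun p => c / (1 + s * c) ^ 2 * p.1 ^ 2 -
      2 * c * k / (1 + s * c) * (p.1 * p.2) + c / (1 + s * c) * p.2 ^ 2 := by
    funext p
    have : c / (1 + s * c) = c * k ^ 2 := by rw [hkk]; ring
    rw [this, tiltedSq, ← hk]
    field_simp
    ring
  have e1 : ∫ p : ℝ × ℝ, p.1 ^ 2 ∂stdPair = 1 := by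
    rw [stdPair, integral_fun_fst (fun x : ℝ => x ^ 2), integral_sq_gaussianReal]; simp
  have e2 : ∫ p : ℝ × ℝ, p.1 * p.2 ∂stdPair = 0 := by
    rw [stdPair, integral_prod_mul (fun x : ℝ => x) (fun x : ℝ => x)]; simp
  have e3 : ∫ p : ℝ × ℝ, p.2 ^ 2 ∂stdPair = 1 := by
    rw [stdPair, integral_fun_snd (fun x : ℝ => x ^ 2), integral_sq_gaussianReal]; simp
  have hadd := integral_add (i1.sub i2) i3
  simp only [Pi.sub_apply] at hadd
  simp only [this]
  rw [hadd, integral_sub i1 i2, integral_const_mul,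
    integral_const_mul, integral_const_mul, e1, e2, e3]
  ring

/-- The law of `d` independent pairs of independent standard Gaussian variables. -/
noncomputable def pairPi (d : ℕ) : Measure (Fin d → ℝ × ℝ) := Measure.pi fun _ => stdPair

instance : IsProbabilityMeasure (pairPi d) := by unfold pairPi; infer_instance

theorem integrable_tiltedSq_pow_eval {s c : ℝ} (hs : 0 < s) (hc : 0 ≤ c) (n : ℕ) (i : Fin d) :
    Integrable (fun q : Fin d → ℝ × ℝ => tiltedSq s c (q i) ^ n) (pairPi d) :=
  integrable_comp_eval (μ := fun _ : Fin d => stdPair) (f := fun p => tiltedSq s c p ^ n)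
    (integrable_tiltedSq_pow hs hc n)

/-- Regrouping `(x, y)` by coordinates exhibits the tilted squared distance as a mean of independent
terms, one for each pair. -/
theorem measurePreserving_pairPi :
    MeasurePreserving (MeasurableEquiv.arrowProdEquivProdArrow ℝ ℝ (Fin d)) (pairPi d)
      ((stdPi d).prod (stdPi d)) :=
  measurePreserving_arrowProdEquivProdArrow ℝ ℝ (Fin d) (fun _ => gaussianReal 0 1)
    (fun _ => gaussianReal 0 1)

theorem integral_comp_tiltedSqDist (s : ℝ) (c : Fin d → ℝ) (f : ℝ → ℝ) :
    ∫ p, f (tiltedSqDist s c p.1 p.2) ∂((stdPi d).prod (stdPi d)) =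
      ∫ q, f ((∑ i, tiltedSq s (c i) (q i)) / d) ∂(pairPi d) := by
  rw [← measurePreserving_pairPi.integral_comp' (g := fun p : (Fin d → ℝ) × (Fin d → ℝ) =>
    f (tiltedSqDist s c p.1 p.2))]
  rfl

theorem integrable_comp_tiltedSqDist (s : ℝ) (c : Fin d → ℝ) (f : ℝ → ℝ) :
    Integrable (fun p : (Fin d → ℝ) × (Fin d → ℝ) => f (tiltedSqDist s c p.1 p.2))
      ((stdPi d).prod (stdPi d)) ↔
      Integrable (fun q => f ((∑ i, tiltedSq s (c i) (q i)) / d)) (pairPi d) := by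
  rw [← measurePreserving_pairPi.integrable_comp_emb (MeasurableEquiv.measurableEmbedding _)]
  rfl

theorem mean_pow_le (hd : d ≠ 0) {z : Fin d → ℝ} (hz : ∀ i, 0 ≤ z i) (n : ℕ) :
    ((∑ i, z i) / d) ^ n ≤ (∑ i, z i ^ n) / d := by
  have hd' : (d : ℝ) ≠ 0 := by exact_mod_cast hd
  have h := Real.pow_arith_mean_le_arith_mean_pow Finset.univ (fun _ : Fin d => (d : ℝ)⁻¹) z
    (fun i _ => by positivity) (by simp [hd']) (fun i _ => hz i) n
  rw [← Finset.mul_sum, ← Finset.mul_sum] at h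
  rwa [div_eq_inv_mul, div_eq_inv_mul]

theorem integrable_tiltedSqDist_pow (hd : d ≠ 0) {s : ℝ} (hs : 0 < s) {c : Fin d → ℝ}
    (hc : ∀ i, 0 ≤ c i) (n : ℕ) :
    Integrable (fun p : (Fin d → ℝ) × (Fin d → ℝ) => tiltedSqDist s c p.1 p.2 ^ n)
      ((stdPi d).prod (stdPi d)) := by
  refine (integrable_comp_tiltedSqDist s c fun r => r ^ n).2 ?_
  have hi : Integrable (fun q : Fin d → ℝ × ℝ => (∑ i, tiltedSq s (c i) (q i) ^ n) / d)
      (pairPi d) := (integrable_finsetSum _ fun i _ =>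
    integrable_tiltedSq_pow_eval hs (hc i) n i).div_const _
  refine hi.mono' (Measurable.aestronglyMeasurable (by fun_prop)) (Eventually.of_forall fun q => ?_)
  have h0 : ∀ i, 0 ≤ tiltedSq s (c i) (q i) := fun i => tiltedSq_nonneg s (hc i) _
  rw [Real.norm_eq_abs, abs_of_nonneg (pow_nonneg
    (div_nonneg (Finset.sum_nonneg fun i _ => h0 i) (Nat.cast_nonneg d)) n)]
  exact mean_pow_le hd h0 n

theorem integral_tiltedSqDist_pow_le (hd : d ≠ 0) {s : ℝ} (hs : 0 < s) {c : Fin d → ℝ}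
    (hc : ∀ i, 0 ≤ c i) (n : ℕ) :
    ∫ p, tiltedSqDist s c p.1 p.2 ^ n ∂((stdPi d).prod (stdPi d)) ≤
      (s⁻¹) ^ n * pairMoment (2 * n) := by
  have hd' : (0 : ℝ) < d := by exact_mod_cast Nat.pos_of_ne_zero hd
  have hii : ∀ i, Integrable (fun q : Fin d → ℝ × ℝ => tiltedSq s (c i) (q i) ^ n) (pairPi d) :=
    fun i => integrable_tiltedSq_pow_eval hs (hc i) n i
  rw [integral_comp_tiltedSqDist s c fun r => r ^ n]
  calc ∫ q, ((∑ i, tiltedSq s (c i) (q i)) / d) ^ n ∂(pairPi d)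
      ≤ ∫ q, (∑ i, tiltedSq s (c i) (q i) ^ n) / d ∂(pairPi d) :=
        integral_mono ((integrable_comp_tiltedSqDist s c fun r => r ^ n).1
          (integrable_tiltedSqDist_pow hd hs hc n))
          ((integrable_finsetSum _ fun i _ => hii i).div_const _)
          fun q => mean_pow_le hd (fun i => tiltedSq_nonneg s (hc i) _) n
    _ = (∑ i, ∫ p, tiltedSq s (c i) p ^ n ∂stdPair) / d := by
        rw [integral_div, integral_finsetSum _ fun i _ => hii i]
        congr 1
        refine Finset.sum_congr rfl fun i _ => ?_
        exact integral_comp_eval (μ := fun _ : Fin d => stdPair) (i := i)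
          (f := fun p => tiltedSq s (c i) p ^ n) (Measurable.aestronglyMeasurable (by fun_prop))
    _ ≤ (∑ _i : Fin d, (s⁻¹) ^ n * pairMoment (2 * n)) / d := by
        gcongr with i
        exact integral_tiltedSq_pow_le hs (hc i) n
    _ = _ := by
        rw [Finset.sum_const, Finset.card_univ, Fintype.card_fin, nsmul_eq_mul]
        field_simp

/-- The mean of the tilted squared distance. -/
noncomputable def tiltedMean (s : ℝ) (c : Fin d → ℝ) : ℝ :=
  (∑ i, (c i / (1 + s * c i) + c i / (1 + s * c i) ^ 2)) / d

theorem tiltedMean_nonneg {s : ℝ} (hs : 0 ≤ s) {c : Fin d → ℝ} (hc : ∀ i, 0 ≤ c i) :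
    0 ≤ tiltedMean s c := by
  refine div_nonneg (Finset.sum_nonneg fun i _ => ?_) (Nat.cast_nonneg d)
  have := hc i
  positivity

theorem integral_tiltedSqDist {s : ℝ} (hs : 0 < s) {c : Fin d → ℝ} (hc : ∀ i, 0 ≤ c i) :
    ∫ p, tiltedSqDist s c p.1 p.2 ∂((stdPi d).prod (stdPi d)) = tiltedMean s c := by
  rw [integral_comp_tiltedSqDist s c fun r => r, integral_div, integral_finsetSum, tiltedMean]
  · congr 1
    refine Finset.sum_congr rfl fun i _ => ?_
    rw [← integral_tiltedSq hs.le (hc i)]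
    exact integral_comp_eval (μ := fun _ : Fin d => stdPair) (i := i)
      (f := tiltedSq s (c i)) (Measurable.aestronglyMeasurable (by fun_prop))
  · intro i _
    refine integrable_comp_eval (μ := fun _ : Fin d => stdPair) (f := tiltedSq s (c i)) ?_
    simpa using integrable_tiltedSq_pow hs (hc i) 1

/-- Variances of independent terms add, and each is at most its second moment, bounded uniformly in
`c`; the factor `1/d²` leaves order `1/d`. -/
theorem integral_sq_tiltedSqDist_sub_mean_le (hd : d ≠ 0) {s : ℝ} (hs : 0 < s) {c : Fin d → ℝ}
    (hc : ∀ i, 0 ≤ c i) :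
    ∫ p, (tiltedSqDist s c p.1 p.2 - tiltedMean s c) ^ 2 ∂((stdPi d).prod (stdPi d)) ≤
      (s⁻¹) ^ 2 * pairMoment 4 / d := by
  have hd' : (0 : ℝ) < d := by exact_mod_cast Nat.pos_of_ne_zero hd
  have hm : ∀ i, MemLp (tiltedSq s (c i)) 2 stdPair := fun i =>
    (memLp_two_iff_integrable_sq (Measurable.aestronglyMeasurable (by fun_prop))).2
      (integrable_tiltedSq_pow hs (hc i) 2)
  have hvar := variance_sum_pi (μ := fun _ : Fin d => stdPair) hm
  have hmean : tiltedMean s c = ∫ q, (∑ i, tiltedSq s (c i) (q i)) / d ∂(pairPi d) := by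
    rw [← integral_tiltedSqDist hs hc, integral_comp_tiltedSqDist s c fun r => r]
  rw [integral_comp_tiltedSqDist s c fun r => (r - tiltedMean s c) ^ 2, hmean,
    ← variance_eq_integral (Measurable.aemeasurable (by fun_prop))]
  have : (fun q : Fin d → ℝ × ℝ => (∑ i, tiltedSq s (c i) (q i)) / d) =
      fun q => (d : ℝ)⁻¹ * (∑ i, fun q : Fin d → ℝ × ℝ => tiltedSq s (c i) (q i)) q := by
    funext q; rw [Finset.sum_apply, div_eq_inv_mul]
  rw [this, variance_const_mul, pairPi, hvar]
  have hle : ∀ i ∈ Finset.univ, Var[tiltedSq s (c i); stdPair] ≤ (s⁻¹) ^ 2 * pairMoment 4 :=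
    fun i _ => (variance_le_expectation_sq (Measurable.aestronglyMeasurable (by fun_prop))).trans
      (integral_tiltedSq_pow_le hs (hc i) 2)
  calc ((d : ℝ)⁻¹) ^ 2 * ∑ i, Var[tiltedSq s (c i); stdPair]
      ≤ ((d : ℝ)⁻¹) ^ 2 * ∑ _i : Fin d, (s⁻¹) ^ 2 * pairMoment 4 := by
        gcongr with i hi
        exact hle i hi
    _ = _ := by
        rw [Finset.sum_const, Finset.card_univ, Fintype.card_fin, nsmul_eq_mul]
        field_simp

end GaussKDE

/-! ### Concentration of the tilted distance and matching bounds for the mean log-Laplace functional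
-/

namespace GaussKDE

variable {d : ℕ}

/-- A nonnegative function whose increments grow at most polynomially. -/
structure PolyGrowth (Φ : ℝ → ℝ) (B : ℝ) (n : ℕ) : Prop where
  measurable : Measurable Φ
  nonneg : ∀ r, 0 ≤ r → 0 ≤ Φ r
  const_nonneg : 0 ≤ B
  sub_le : ∀ r r₀, 0 ≤ r → 0 ≤ r₀ → Φ r - Φ r₀ ≤ B * (1 + r ^ n) * |r - r₀|

/-- The constant in the bound for the expectation of `Φ` at the tilted squared distance. -/
noncomputable def fluctConst (s : ℝ) (n : ℕ) : ℝ :=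
  1 + (s⁻¹) ^ (2 * n) * pairMoment (2 * (2 * n)) + (s⁻¹) ^ 2 * pairMoment 4 / 2

theorem integrable_comp_tiltedSqDist_of_polyGrowth {Φ : ℝ → ℝ} {B : ℝ} {n : ℕ}
    (hΦ : PolyGrowth Φ B n) (hd : d ≠ 0) {s : ℝ} (hs : 0 < s) {c : Fin d → ℝ}
    (hc : ∀ i, 0 ≤ c i) :
    Integrable (fun p : (Fin d → ℝ) × (Fin d → ℝ) => Φ (tiltedSqDist s c p.1 p.2))
      ((stdPi d).prod (stdPi d)) := by
  have hm := hΦ.measurable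
  have h1 := integrable_tiltedSqDist_pow hd hs hc 1
  have h2 := integrable_tiltedSqDist_pow hd hs hc (n + 1)
  refine ((integrable_const (Φ 0)).add ((h1.add h2).const_mul B)).mono'
    (Measurable.aestronglyMeasurable (by fun_prop)) (Eventually.of_forall fun p => ?_)
  have hr := tiltedSqDist_nonneg hc s p.1 p.2
  rw [Real.norm_eq_abs, abs_of_nonneg (hΦ.nonneg _ hr)]
  have := hΦ.sub_le _ 0 hr le_rfl
  rw [sub_zero, abs_of_nonneg hr] at this
  simp only [Pi.add_apply]
  linear_combination this

/-- Only this one-sided estimate is needed, because `Φ` enters the Jensen lower bound with a minus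
sign. -/
theorem integral_comp_tiltedSqDist_le {Φ : ℝ → ℝ} {B : ℝ} {n : ℕ}
    (hΦ : PolyGrowth Φ B n) (hd : d ≠ 0) {s : ℝ} (hs : 0 < s) {c : Fin d → ℝ}
    (hc : ∀ i, 0 ≤ c i) :
    ∫ p, Φ (tiltedSqDist s c p.1 p.2) ∂((stdPi d).prod (stdPi d)) ≤
      Φ (tiltedMean s c) + B * fluctConst s n / Real.sqrt d := by
  have hd' : (0 : ℝ) < d := by exact_mod_cast Nat.pos_of_ne_zero hd
  set l := tiltedMean s c with hl
  set P := (stdPi d).prod (stdPi d)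
  set ε := Real.sqrt d with hε
  have hε0 : 0 < ε := Real.sqrt_pos.2 hd'
  have hεε : ε ^ 2 = d := Real.sq_sqrt hd'.le
  have hm := hΦ.measurable
  have h1 := integrable_tiltedSqDist_pow hd hs hc 1
  have h2 := integrable_tiltedSqDist_pow hd hs hc 2
  have hn := integrable_tiltedSqDist_pow hd hs hc (2 * n)
  have hsq : Integrable (fun p : (Fin d → ℝ) × (Fin d → ℝ) =>
      (tiltedSqDist s c p.1 p.2 - l) ^ 2) P := by
    refine ((h2.sub (h1.const_mul (2 * l))).add (integrable_const (l ^ 2))).congr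
      (Eventually.of_forall fun p => ?_)
    simp only [Pi.add_apply, Pi.sub_apply]
    ring
  have e0 : Integrable (fun p : (Fin d → ℝ) × (Fin d → ℝ) =>
      1 + tiltedSqDist s c p.1 p.2 ^ (2 * n)) P := (integrable_const _).add hn
  have e1 : Integrable (fun p : (Fin d → ℝ) × (Fin d → ℝ) =>
      Φ l + B / ε * (1 + tiltedSqDist s c p.1 p.2 ^ (2 * n))) P :=
    (integrable_const _).add (e0.const_mul _)
  have e2 : Integrable (fun p : (Fin d → ℝ) × (Fin d → ℝ) =>
      B * ε / 2 * (tiltedSqDist s c p.1 p.2 - l) ^ 2) P := hsq.const_mul _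
  have hle : ∀ p : (Fin d → ℝ) × (Fin d → ℝ), Φ (tiltedSqDist s c p.1 p.2) ≤
      Φ l + B / ε * (1 + tiltedSqDist s c p.1 p.2 ^ (2 * n)) +
        B * ε / 2 * (tiltedSqDist s c p.1 p.2 - l) ^ 2 := by
    intro p
    set r := tiltedSqDist s c p.1 p.2
    have hr : 0 ≤ r := tiltedSqDist_nonneg hc s p.1 p.2
    have h3 := hΦ.sub_le r l hr (tiltedMean_nonneg hs.le hc)
    -- Young's inequality with weight `ε = √d` balances the two errors: moments divided by `√d`, and
    -- `√d` times a variance of order `1/d`.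
    have h4 : (1 + r ^ n) * |r - l| ≤ 1 / ε * (1 + r ^ (2 * n)) + ε / 2 * (r - l) ^ 2 := by
      have h5 : 0 ≤ (1 / (2 * ε)) * ((1 + r ^ n) - ε * |r - l|) ^ 2 := by positivity
      have h6 : 0 ≤ (1 / (2 * ε)) * (1 - r ^ n) ^ 2 := by positivity
      have h7 : 1 / ε * (1 + r ^ (2 * n)) + ε / 2 * (r - l) ^ 2 - (1 + r ^ n) * |r - l| =
          (1 / (2 * ε)) * ((1 + r ^ n) - ε * |r - l|) ^ 2 + (1 / (2 * ε)) * (1 - r ^ n) ^ 2 := by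
        rw [← sq_abs (r - l), pow_mul']
        field_simp
        ring
      linarith
    have h8 := mul_le_mul_of_nonneg_left h4 hΦ.const_nonneg
    linear_combination h3 + h8
  calc ∫ p, Φ (tiltedSqDist s c p.1 p.2) ∂P
      ≤ ∫ p, (Φ l + B / ε * (1 + tiltedSqDist s c p.1 p.2 ^ (2 * n)) +
        B * ε / 2 * (tiltedSqDist s c p.1 p.2 - l) ^ 2) ∂P :=
        integral_mono (integrable_comp_tiltedSqDist_of_polyGrowth hΦ hd hs hc) (e1.add e2) hle
    _ = Φ l + B / ε * (1 + ∫ p, tiltedSqDist s c p.1 p.2 ^ (2 * n) ∂P) +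
        B * ε / 2 * ∫ p, (tiltedSqDist s c p.1 p.2 - l) ^ 2 ∂P := by
        rw [integral_add e1 e2, integral_add (integrable_const _)
          (e0.const_mul _), integral_const_mul, integral_const_mul,
          integral_add (integrable_const _) hn]
        simp [P]
    _ ≤ Φ l + B / ε * (1 + (s⁻¹) ^ (2 * n) * pairMoment (2 * (2 * n))) +
        B * ε / 2 * ((s⁻¹) ^ 2 * pairMoment 4 / d) := by
        have := hΦ.const_nonneg
        gcongr
        · exact integral_tiltedSqDist_pow_le hd hs hc _
        · exact integral_sq_tiltedSqDist_sub_mean_le hd hs hc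
    _ = _ := by
        rw [fluctConst, ← hεε]
        field_simp
        ring

/-- The mean over `x` of the normalised logarithm of the tilting factor, up to sign. -/
noncomputable def tiltedEntropy (s : ℝ) (c : Fin d → ℝ) : ℝ :=
  (∑ i, 1 / 2 * (Real.log (1 + s * c i) + s * c i / (1 + s * c i))) / d

theorem integrable_log_tiltNorm_eval {s : ℝ} (hs : 0 ≤ s) {c : Fin d → ℝ} (hc : ∀ i, 0 ≤ c i)
    (i : Fin d) : Integrable (fun x : Fin d → ℝ => Real.log (tiltNorm (s * c i) (x i)))
      (stdPi d) := by
  simp only [log_tiltNorm (mul_nonneg hs (hc i))]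
  exact integrable_comp_eval (μ := fun _ : Fin d => gaussianReal 0 1)
    (f := fun x => -(1 / 2) * Real.log (1 + s * c i) - s * c i / (2 * (1 + s * c i)) * x ^ 2)
    ((integrable_const _).sub (integrable_sq_gaussianReal.const_mul _))

theorem integral_sum_log_tiltNorm (hd : d ≠ 0) {s : ℝ} (hs : 0 ≤ s) {c : Fin d → ℝ}
    (hc : ∀ i, 0 ≤ c i) :
    ∫ x, ∑ i, Real.log (tiltNorm (s * c i) (x i)) ∂(stdPi d) = -(d * tiltedEntropy s c) := by
  have hd' : (d : ℝ) ≠ 0 := by exact_mod_cast hd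
  rw [integral_finsetSum _ fun i _ => integrable_log_tiltNorm_eval hs hc i, tiltedEntropy,
    mul_div_cancel₀ _ hd', ← Finset.sum_neg_distrib]
  refine Finset.sum_congr rfl fun i _ => ?_
  have h0 : 0 < 1 + s * c i := by have := mul_nonneg hs (hc i); linarith
  simp only [log_tiltNorm (mul_nonneg hs (hc i))]
  have := integral_comp_eval (μ := fun _ : Fin d => gaussianReal 0 1) (i := i)
    (f := fun x => -(1 / 2) * Real.log (1 + s * c i) - s * c i / (2 * (1 + s * c i)) * x ^ 2)
    (Measurable.aestronglyMeasurable (by fun_prop))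
  rw [stdPi, this, integral_sub (integrable_const _) (integrable_sq_gaussianReal.const_mul _),
    integral_const_mul (s * c i / (2 * (1 + s * c i))), integral_sq_gaussianReal]
  simp only [integral_const, probReal_univ, smul_eq_mul]
  field_simp
  ring

theorem integrable_sum_log_tiltNorm {s : ℝ} (hs : 0 ≤ s) {c : Fin d → ℝ} (hc : ∀ i, 0 ≤ c i) :
    Integrable (fun x : Fin d → ℝ => ∑ i, Real.log (tiltNorm (s * c i) (x i))) (stdPi d) :=
  integrable_finsetSum _ fun i _ => integrable_log_tiltNorm_eval hs hc i

/-- The integrability of the log-Laplace functional, and the two bounds on its mean. -/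
theorem integral_logLaplace_bounds {Φ : ℝ → ℝ} {B : ℝ} {n : ℕ}
    (hΦ : PolyGrowth Φ B n) (hd : d ≠ 0) {s l : ℝ} (hs : 0 < s)
    (htan : ∀ r, 0 ≤ r → Φ l + s / 2 * (r - l) ≤ Φ r) {c : Fin d → ℝ}
    (hc : ∀ i, 0 ≤ c i) :
    Integrable (logLaplace Φ c) (stdPi d) ∧
      (∫ x, logLaplace Φ c x ∂(stdPi d)) / d ≤ -Φ l + s * l / 2 - tiltedEntropy s c ∧
      s / 2 * tiltedMean s c - Φ (tiltedMean s c) - B * fluctConst s n / Real.sqrt d -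
        tiltedEntropy s c ≤ (∫ x, logLaplace Φ c x ∂(stdPi d)) / d := by
  have hd' : (0 : ℝ) < d := by exact_mod_cast Nat.pos_of_ne_zero hd
  set N : (Fin d → ℝ) → ℝ := fun x => ∑ i, Real.log (tiltNorm (s * c i) (x i)) with hN
  have hNi : Integrable N (stdPi d) := integrable_sum_log_tiltNorm hs.le hc
  have hNint : ∫ x, N x ∂(stdPi d) = -(d * tiltedEntropy s c) :=
    integral_sum_log_tiltNorm hd hs.le hc
  have i1 : Integrable (fun p : (Fin d → ℝ) × (Fin d → ℝ) => tiltedSqDist s c p.1 p.2)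
      ((stdPi d).prod (stdPi d)) := by simpa using integrable_tiltedSqDist_pow hd hs hc 1
  have i2 := integrable_comp_tiltedSqDist_of_polyGrowth hΦ hd hs hc
  have i3 := (i1.const_mul (s / 2)).sub i2
  set V : (Fin d → ℝ) → ℝ := fun x =>
    ∫ y, (s / 2 * tiltedSqDist s c x y - Φ (tiltedSqDist s c x y)) ∂(stdPi d) with hV
  have hVi : Integrable V (stdPi d) := i3.integral_prod_left
  have hVint : ∫ x, V x ∂(stdPi d) = s / 2 * tiltedMean s c -
      ∫ p, Φ (tiltedSqDist s c p.1 p.2) ∂((stdPi d).prod (stdPi d)) := by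
    have h := integral_prod _ i3
    have h' := integral_sub (i1.const_mul (s / 2)) i2
    simp only [Pi.sub_apply] at h
    rw [hV, ← h, h', integral_const_mul, integral_tiltedSqDist hs hc]
  have hub : ∀ x, logLaplace Φ c x ≤ d * (-Φ l + s * l / 2) + N x := fun x =>
    logLaplace_le hd hΦ.measurable hΦ.nonneg hs.le htan hc x
  -- Fubini gives integrability in `y` only for almost every `x`, so the lower bound holds almost
  -- everywhere.
  have hlb : ∀ᵐ x ∂(stdPi d), N x + d * V x ≤ logLaplace Φ c x := by
    filter_upwards [i1.prod_right_ae, i2.prod_right_ae] with x h1 h2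
    exact le_logLaplace hd hΦ.measurable hs.le htan hc x h1 h2
  have hubi : Integrable (fun x => d * (-Φ l + s * l / 2) + N x) (stdPi d) :=
    (integrable_const _).add hNi
  have hlbi : Integrable (fun x => N x + d * V x) (stdPi d) := hNi.add (hVi.const_mul _)
  have hint : Integrable (logLaplace Φ c) (stdPi d) :=
    integrable_of_le_of_le (measurable_logLaplace hΦ.measurable c).aestronglyMeasurable hlb
      (Eventually.of_forall hub) hlbi hubi
  refine ⟨hint, ?_, ?_⟩
  · rw [div_le_iff₀ hd']
    refine (integral_mono hint hubi hub).trans_eq ?_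
    rw [integral_add (integrable_const _) hNi, hNint]
    simp only [integral_const, probReal_univ, smul_eq_mul]
    ring
  · rw [le_div_iff₀ hd']
    refine le_trans ?_ (integral_mono_ae hlbi hint hlb)
    rw [integral_add hNi (hVi.const_mul _), hNint, integral_const_mul, hVint]
    have := integral_comp_tiltedSqDist_le hΦ hd hs hc
    nlinarith

end GaussKDE

namespace GaussKDE

/-! ### Limits of linear spectral statistics -/

/-- The triangular array `c` of nonnegative numbers has bounded means and its empirical measures
converge to `ρ` in the sense of distributions. -/
structure IsSpectralLimit (c : (d : ℕ) → Fin d → ℝ) (M : ℝ) (ρ : Measure ℝ) : Prop where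
  nonneg : ∀ d i, 0 ≤ c d i
  sum_le : ∀ d, ∑ i, c d i ≤ M * d
  tendsto : ∀ φ : ℝ → ℝ, ContDiff ℝ ∞ φ → HasCompactSupport φ →
    Tendsto (fun d : ℕ => (1 / (d : ℝ)) * ∑ i, φ (c d i)) atTop (𝓝 (∫ t, φ t ∂ρ))

/-- A smooth cutoff equal to one on `[0, 2 R]` and supported in `[-δ, 2 R + δ]`. -/
noncomputable def cutoff (R δ : ℝ) (hR : 0 < R) (hδ : 0 < δ) : ContDiffBump R :=
  ⟨R, R + δ, hR, by linarith⟩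

section cutoff

variable {R δ : ℝ} (hR : 0 < R) (hδ : 0 < δ)

theorem cutoff_eq_one {t : ℝ} (h0 : 0 ≤ t) (h1 : t ≤ 2 * R) : cutoff R δ hR hδ t = 1 := by
  refine (cutoff R δ hR hδ).one_of_mem_closedBall ?_
  rw [Metric.mem_closedBall, Real.dist_eq, abs_le]
  change -R ≤ _ ∧ _ ≤ R
  constructor <;> linarith

theorem cutoff_eq_zero {t : ℝ} (h : t ≤ -δ) : cutoff R δ hR hδ t = 0 := by
  refine (cutoff R δ hR hδ).zero_of_le_dist ?_
  rw [Real.dist_eq, abs_of_nonpos (by linarith)]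
  change R + δ ≤ _
  linarith

theorem contDiff_mul_cutoff {g : ℝ → ℝ} {η : ℝ} (hη : δ < η) (hg : ContDiffOn ℝ ∞ g (Set.Ioi (-η))) :
    ContDiff ℝ ∞ fun t => g t * cutoff R δ hR hδ t := by
  rw [contDiff_iff_contDiffAt]
  intro t
  rcases lt_or_ge (-η) t with h | h
  · exact (hg.contDiffAt (Ioi_mem_nhds h)).mul (cutoff R δ hR hδ).contDiff.contDiffAt
  · refine (contDiffAt_const (c := (0 : ℝ))).congr_of_eventuallyEq ?_
    filter_upwards [Iio_mem_nhds (show t < -δ by linarith)] with u hu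
    rw [cutoff_eq_zero hR hδ (le_of_lt hu), mul_zero]

theorem hasCompactSupport_mul_cutoff (g : ℝ → ℝ) :
    HasCompactSupport fun t => g t * cutoff R δ hR hδ t :=
  (cutoff R δ hR hδ).hasCompactSupport.mul_left

end cutoff

variable {c : (d : ℕ) → Fin d → ℝ} {M : ℝ} {ρ : Measure ℝ}

theorem IsSpectralLimit.bound_nonneg (h : IsSpectralLimit c M ρ) : 0 ≤ M := by
  have := (Finset.sum_nonneg fun i _ => h.nonneg 1 i).trans (h.sum_le 1)
  simpa using this

theorem IsSpectralLimit.mean_le (h : IsSpectralLimit c M ρ) (d : ℕ) :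
    1 / (d : ℝ) * ∑ i, c d i ≤ M := by
  rcases eq_or_ne d 0 with rfl | hd
  · simpa using h.bound_nonneg
  · have : (0 : ℝ) < d := by exact_mod_cast Nat.pos_of_ne_zero hd
    rw [one_div_mul_eq_div, div_le_iff₀ this]
    exact h.sum_le d

/-- A bump supported in the negative half line vanishes at every eigenvalue, so its `ρ`-integral, a
limit of zeros, is zero. -/
theorem IsSpectralLimit.measure_Iio [IsProbabilityMeasure ρ] (h : IsSpectralLimit c M ρ) :
    ρ (Set.Iio 0) = 0 := by
  refine measure_null_of_locally_null _ fun t ht => ?_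
  rw [Set.mem_Iio] at ht
  let f : ContDiffBump t := ⟨-t / 2, -t, by linarith, by linarith⟩
  refine ⟨Metric.ball t (-t), mem_nhdsWithin_of_mem_nhds (Metric.ball_mem_nhds t (by linarith)), ?_⟩
  have hlim := h.tendsto f f.contDiff f.hasCompactSupport
  have h0 : ∀ d i, f (c d i) = 0 := fun d i => by
    refine f.zero_of_le_dist ?_
    have := h.nonneg d i
    rw [Real.dist_eq, abs_of_nonneg (by linarith)]
    change -t ≤ _
    linarith
  simp only [h0, Finset.sum_const_zero, mul_zero] at hlim
  have hint : ∫ u, f u ∂ρ = 0 := tendsto_nhds_unique hlim tendsto_const_nhds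
  have hfi : Integrable f ρ := f.continuous.integrable_of_hasCompactSupport f.hasCompactSupport
  rw [integral_eq_zero_iff_of_nonneg (fun u => f.nonneg) hfi] at hint
  refine measure_mono_null (fun u hu => ?_) hint
  exact (f.pos_of_mem_ball hu).ne'

theorem IsSpectralLimit.ae_nonneg [IsProbabilityMeasure ρ] (h : IsSpectralLimit c M ρ) :
    ∀ᵐ t ∂ρ, 0 ≤ t := by
  rw [ae_iff]
  simp only [not_le]
  exact h.measure_Iio

/-- Fatou's lemma on smooth truncations of `t`. Mass may escape to infinity, so only an inequality
with the trace bound survives. -/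
theorem IsSpectralLimit.lintegral_le [IsProbabilityMeasure ρ] (h : IsSpectralLimit c M ρ) :
    ∫⁻ t, ENNReal.ofReal t ∂ρ ≤ ENNReal.ofReal M := by
  set φ : ℕ → ℝ → ℝ := fun n t => t * cutoff (n + 1) 1 (by positivity) one_pos t with hφ
  have hφc : ∀ n, ContDiff ℝ ∞ (φ n) := fun n =>
    contDiff_mul_cutoff _ _ (one_lt_two) contDiff_id.contDiffOn
  have hφs : ∀ n, HasCompactSupport (φ n) := fun n => hasCompactSupport_mul_cutoff _ _ _
  have hφi : ∀ n, Integrable (φ n) ρ := fun n =>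
    (hφc n).continuous.integrable_of_hasCompactSupport (hφs n)
  have hint : ∀ n, ∫ t, φ n t ∂ρ ≤ M := fun n => by
    refine le_of_tendsto' (h.tendsto _ (hφc n) (hφs n)) fun d => le_trans ?_ (h.mean_le d)
    gcongr with i
    exact mul_le_of_le_one_right (h.nonneg d i) (ContDiffBump.le_one _)
  calc ∫⁻ t, ENNReal.ofReal t ∂ρ
      ≤ ∫⁻ t, liminf (fun n => ENNReal.ofReal (φ n t)) atTop ∂ρ := by
        refine lintegral_mono_ae ?_
        filter_upwards [h.ae_nonneg] with t ht
        refine le_of_eq (Tendsto.liminf_eq ?_).symm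
        refine tendsto_const_nhds.congr' ?_
        filter_upwards [eventually_ge_atTop ⌈t⌉₊] with n hn
        have : t ≤ n := (Nat.le_ceil t).trans (by exact_mod_cast hn)
        rw [hφ]
        simp only
        rw [cutoff_eq_one _ _ ht (by linarith), mul_one]
    _ ≤ liminf (fun n => ∫⁻ t, ENNReal.ofReal (φ n t) ∂ρ) atTop :=
        lintegral_liminf_le fun n => (hφc n).continuous.measurable.ennreal_ofReal
    _ ≤ ENNReal.ofReal M := by
        refine liminf_le_of_frequently_le' (Eventually.frequently (Eventually.of_forall fun n => ?_))
        rw [← ofReal_integral_eq_lintegral_ofReal (hφi n)]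
        · exact ENNReal.ofReal_le_ofReal (hint n)
        · filter_upwards [h.ae_nonneg] with t ht
          exact mul_nonneg ht (ContDiffBump.nonneg _)

theorem IsSpectralLimit.integrable_id [IsProbabilityMeasure ρ] (h : IsSpectralLimit c M ρ) :
    Integrable (fun t => t) ρ := by
  refine ⟨measurable_id.aestronglyMeasurable, ?_⟩
  rw [hasFiniteIntegral_iff_ofReal h.ae_nonneg]
  exact h.lintegral_le.trans_lt ENNReal.ofReal_lt_top

theorem IsSpectralLimit.integral_id_le [IsProbabilityMeasure ρ] (h : IsSpectralLimit c M ρ) :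
    ∫ t, t ∂ρ ≤ M := by
  rw [integral_eq_lintegral_of_nonneg_ae h.ae_nonneg measurable_id.aestronglyMeasurable]
  exact ENNReal.toReal_le_of_le_ofReal h.bound_nonneg h.lintegral_le

/-- A function that is smooth near `[0, ∞)` and of sublinear growth is integrable for the limiting
spectral law, and its spectral means converge. -/
theorem IsSpectralLimit.tendsto_of_sublinear [IsProbabilityMeasure ρ] (h : IsSpectralLimit c M ρ)
    {g : ℝ → ℝ} {η : ℝ} (hη : 0 < η) (hg : ContDiffOn ℝ ∞ g (Set.Ioi (-η)))
    (hsub : ∀ ε, 0 < ε → ∃ A, ∀ t, 0 ≤ t → |g t| ≤ A + ε * t) :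
    Integrable g ρ ∧
      Tendsto (fun d : ℕ => (1 / (d : ℝ)) * ∑ i, g (c d i)) atTop (𝓝 (∫ t, g t ∂ρ)) := by
  have hid := h.integrable_id
  have hM := h.bound_nonneg
  have hmeas : AEStronglyMeasurable g ρ := by
    have h1 : AEStronglyMeasurable g (ρ.restrict (Set.Ici 0)) :=
      (hg.continuousOn.mono fun t ht => lt_of_lt_of_le (by linarith)
        (Set.mem_Ici.1 ht)).aestronglyMeasurable measurableSet_Ici
    rwa [Measure.restrict_eq_self_of_ae_mem (s := Set.Ici (0 : ℝ)) h.ae_nonneg] at h1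
  have hgi : Integrable g ρ := by
    obtain ⟨A, hA⟩ := hsub 1 one_pos
    refine ((integrable_const A).add (hid.const_mul 1)).mono' hmeas ?_
    filter_upwards [h.ae_nonneg] with t ht using hA t ht
  refine ⟨hgi, ?_⟩
  rw [Metric.tendsto_atTop]
  intro ε hε
  -- Truncation costs `2 κ M` on the empirical side and `2 κ M` on the side of `ρ`; weak convergence
  -- must supply the remaining `ε - 4 κ M`.
  obtain ⟨κ, hκ, hκε⟩ : ∃ κ : ℝ, 0 < κ ∧ 4 * κ * M < ε := by
    refine ⟨ε / (4 * M + 4), by positivity, ?_⟩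
    rw [mul_comm 4, mul_assoc, div_mul_eq_mul_div, div_lt_iff₀ (by linarith)]
    nlinarith
  obtain ⟨A, hA⟩ := hsub κ hκ
  -- Beyond `2 R` the constant `A` is at most `κ t`, so there `|g t| ≤ 2 κ t`.
  set R : ℝ := max 1 (A / κ) with hRdef
  have hR : 0 < R := lt_of_lt_of_le one_pos (le_max_left _ _)
  have hAR : A ≤ κ * R := by
    have := le_max_right 1 (A / κ)
    rw [div_le_iff₀ hκ] at this
    linarith
  set χ := cutoff R (η / 2) hR (by linarith) with hχ
  set φ : ℝ → ℝ := fun t => g t * χ t with hφ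
  have hφc : ContDiff ℝ ∞ φ := contDiff_mul_cutoff _ _ (half_lt_self hη) hg
  have hφs : HasCompactSupport φ := hasCompactSupport_mul_cutoff _ _ _
  have hφi : Integrable φ ρ := hφc.continuous.integrable_of_hasCompactSupport hφs
  have hdiff : ∀ t, 0 ≤ t → |g t - φ t| ≤ 2 * κ * t := by
    intro t ht
    rcases le_or_gt t (2 * R) with h1 | h1
    · rw [hφ]
      simp only
      rw [hχ, cutoff_eq_one _ _ ht h1, mul_one, sub_self, abs_zero]
      positivity
    · have h2 : g t - φ t = g t * (1 - χ t) := by rw [hφ]; ring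
      rw [h2, abs_mul, abs_of_nonneg (sub_nonneg.2 χ.le_one)]
      have h3 : 1 - χ t ≤ 1 := by linarith [χ.nonneg' t]
      calc |g t| * (1 - χ t) ≤ |g t| * 1 := by gcongr
        _ ≤ A + κ * t := by rw [mul_one]; exact hA t ht
        _ ≤ 2 * κ * t := by nlinarith
  have hlim := h.tendsto φ hφc hφs
  rw [Metric.tendsto_atTop] at hlim
  obtain ⟨N, hN⟩ := hlim (ε - 4 * κ * M) (by linarith)
  refine ⟨N, fun d hd => ?_⟩
  have h1 := hN d hd
  rw [Real.dist_eq] at h1 ⊢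
  have h2 : |1 / (d : ℝ) * ∑ i, g (c d i) - 1 / (d : ℝ) * ∑ i, φ (c d i)| ≤ 2 * κ * M := by
    rw [← mul_sub, ← Finset.sum_sub_distrib, abs_mul, abs_of_nonneg (by positivity)]
    calc 1 / (d : ℝ) * |∑ i, (g (c d i) - φ (c d i))|
        ≤ 1 / (d : ℝ) * ∑ i, 2 * κ * c d i := by
          gcongr
          refine (Finset.abs_sum_le_sum_abs _ _).trans ?_
          gcongr with i
          exact hdiff _ (h.nonneg d i)
      _ = 2 * κ * (1 / (d : ℝ) * ∑ i, c d i) := by rw [← Finset.mul_sum]; ring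
      _ ≤ 2 * κ * M := by
          gcongr
          exact h.mean_le d
  have h3 : |∫ t, φ t ∂ρ - ∫ t, g t ∂ρ| ≤ 2 * κ * M := by
    rw [abs_sub_comm, ← integral_sub hgi hφi]
    calc |∫ t, (g t - φ t) ∂ρ| ≤ ∫ t, |g t - φ t| ∂ρ := abs_integral_le_integral_abs
      _ ≤ ∫ t, 2 * κ * t ∂ρ := by
          refine integral_mono_ae (hgi.sub hφi).abs (hid.const_mul _) ?_
          filter_upwards [h.ae_nonneg] with t ht using hdiff t ht
      _ = 2 * κ * ∫ t, t ∂ρ := integral_const_mul _ _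
      _ ≤ 2 * κ * M := by
          gcongr
          exact h.integral_id_le
  rw [abs_lt] at h1 ⊢
  rw [abs_le] at h2 h3
  constructor <;> linarith [h1.1, h1.2, h2.1, h2.2, h3.1, h3.2]

end GaussKDE

namespace GaussKDE

/-! ### The functionals of the limiting spectral law -/

/-- A probability law on `[0, ∞)` with finite mean, different from the point mass at zero. -/
structure IsSpectralLaw (ρ : Measure ℝ) : Prop where
  isProb : IsProbabilityMeasure ρ
  ae_nonneg : ∀ᵐ t ∂ρ, 0 ≤ t
  integrable_id : Integrable (fun t => t) ρ
  ne_dirac : ρ ≠ Measure.dirac 0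

/-- The mean of the limiting tilted squared distance. -/
noncomputable def meanFun (ρ : Measure ℝ) (s : ℝ) : ℝ :=
  ∫ t, (t / (1 + s * t) + t / (1 + s * t) ^ 2) ∂ρ

/-- The limit of the mean logarithm of the tilting factor, up to sign. -/
noncomputable def entropyFun (ρ : Measure ℝ) (s : ℝ) : ℝ :=
  ∫ t, 1 / 2 * (Real.log (1 + s * t) + s * t / (1 + s * t)) ∂ρ

/-- `(1 / 2) ∫ integrand (s t) ρ(dt)`. -/
noncomputable def gapFun (ρ : Measure ℝ) (s : ℝ) : ℝ := 1 / 2 * ∫ t, integrand (s * t) ∂ρ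

/-- This is how `ρ ≠ δ₀` enters: it makes `meanFun` positive and `gapFun` strictly increasing and
unbounded. -/
theorem IsSpectralLaw.measure_Ioi {ρ : Measure ℝ} (hρ : IsSpectralLaw ρ) : ρ (Set.Ioi 0) ≠ 0 := by
  have := hρ.isProb
  intro h
  apply hρ.ne_dirac
  have hz : ∀ᵐ t ∂ρ, t = 0 := by
    have h' : ∀ᵐ t ∂ρ, ¬ 0 < t := by
      rw [ae_iff]
      simp only [not_not]
      exact h
    filter_upwards [h', hρ.ae_nonneg] with t h1 h2 using le_antisymm (not_lt.1 h1) h2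
  have h2 : ρ.map (fun t => t) = ρ.map (fun _ => (0 : ℝ)) := Measure.map_congr hz
  rw [Measure.map_id', Measure.map_const, measure_univ, one_smul] at h2
  exact h2

section pointwise

variable {s t : ℝ}

theorem meanIntegrand_nonneg (hs : 0 ≤ s) (ht : 0 ≤ t) :
    0 ≤ t / (1 + s * t) + t / (1 + s * t) ^ 2 := by positivity

theorem meanIntegrand_anti {s' : ℝ} (hs : 0 ≤ s) (h : s ≤ s') (ht : 0 ≤ t) :
    t / (1 + s' * t) + t / (1 + s' * t) ^ 2 ≤ t / (1 + s * t) + t / (1 + s * t) ^ 2 := by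
  have := mul_nonneg hs ht
  gcongr

theorem meanIntegrand_le (hs : 0 ≤ s) (ht : 0 ≤ t) :
    t / (1 + s * t) + t / (1 + s * t) ^ 2 ≤ 2 * t := by
  have := meanIntegrand_anti le_rfl hs ht
  simp only [zero_mul, add_zero, one_pow, div_one] at this
  linarith

theorem log_one_add_le {u : ℝ} (hu : 0 ≤ u) : Real.log (1 + u) ≤ u := by
  have := Real.log_le_sub_one_of_pos (show 0 < 1 + u by linarith)
  linarith

theorem div_one_add_le {u : ℝ} (hu : 0 ≤ u) : u / (1 + u) ≤ u :=
  div_le_self hu (by linarith)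

/-- Concavity in `s`: with `u = 1 + s t` the function is `(log u + 1 - 1/u) / 2`, both `log u` and
`-1/u` lie below their tangents, and the slope is half the integrand of `meanFun`. -/
theorem entropyIntegrand_tangent {s' : ℝ} (hs : 0 ≤ s) (hs' : 0 ≤ s') (ht : 0 ≤ t) :
    1 / 2 * (Real.log (1 + s' * t) + s' * t / (1 + s' * t)) ≤
      1 / 2 * (Real.log (1 + s * t) + s * t / (1 + s * t)) +
        (s' - s) / 2 * (t / (1 + s * t) + t / (1 + s * t) ^ 2) := by
  have h1 : 0 < 1 + s * t := by positivity
  have h2 : 0 < 1 + s' * t := by positivity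
  set u := 1 + s * t with hu
  set v := 1 + s' * t with hv
  have e1 : s * t / u = 1 - 1 / u := by rw [hu]; field_simp; ring
  have e2 : s' * t / v = 1 - 1 / v := by rw [hv]; field_simp; ring
  have hl : Real.log v ≤ Real.log u + (v - u) / u := by
    have := Real.log_le_sub_one_of_pos (div_pos h2 h1)
    rw [Real.log_div h2.ne' h1.ne'] at this
    rw [sub_div, div_self h1.ne']
    linarith
  have hi : 1 / u - 1 / v ≤ (v - u) / u ^ 2 := by
    have : (v - u) / u ^ 2 - (1 / u - 1 / v) = (v - u) ^ 2 / (u ^ 2 * v) := by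
      field_simp
    have h0 : 0 ≤ (v - u) ^ 2 / (u ^ 2 * v) := by positivity
    linarith
  have e3 : (s' - s) / 2 * (t / u + t / u ^ 2) = 1 / 2 * ((v - u) / u + (v - u) / u ^ 2) := by
    rw [hu, hv]; ring
  rw [e1, e2, e3]
  linarith

theorem entropy_sub_mean_eq (hs : 0 ≤ s) (ht : 0 ≤ t) :
    1 / 2 * (Real.log (1 + s * t) + s * t / (1 + s * t)) -
      s / 2 * (t / (1 + s * t) + t / (1 + s * t) ^ 2) = 1 / 2 * integrand (s * t) := by
  have h1 : 0 < 1 + s * t := by positivity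
  rw [integrand]
  field_simp
  ring

/-- The derivative is `(u² + 3u) / (1 + u)³`. -/
theorem integrand_strictMonoOn : StrictMonoOn integrand (Set.Ici 0) := by
  have hd : ∀ u : ℝ, 0 ≤ u → HasDerivAt integrand
      ((u ^ 2 + 3 * u) / (1 + u) ^ 3) u := by
    intro u hu
    have h1 : 1 + u ≠ 0 := by positivity
    have ha : HasDerivAt (fun u : ℝ => 1 + u) 1 u := (hasDerivAt_id u).const_add 1
    have := (ha.log h1).sub ((hasDerivAt_id u).div (ha.pow 2) (pow_ne_zero 2 h1))
    convert! this using 1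
    simp only [id, Nat.cast_ofNat, Pi.pow_apply]
    field_simp
    ring
  refine strictMonoOn_of_deriv_pos (convex_Ici 0)
    (fun u hu => (hd u hu).continuousAt.continuousWithinAt) fun u hu => ?_
  rw [interior_Ici, Set.mem_Ioi] at hu
  rw [(hd u hu.le).deriv]
  positivity

theorem integrand_zero : integrand 0 = 0 := by simp [integrand]

theorem integrand_nonneg {u : ℝ} (hu : 0 ≤ u) : 0 ≤ integrand u := by
  rw [← integrand_zero]
  exact integrand_strictMonoOn.monotoneOn Set.self_mem_Ici hu hu

theorem integrand_le {u : ℝ} (hu : 0 ≤ u) : integrand u ≤ u := by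
  have := log_one_add_le hu
  have : 0 ≤ u / (1 + u) ^ 2 := by positivity
  rw [integrand]
  linarith

theorem log_sub_one_le_integrand {u : ℝ} (hu : 0 ≤ u) : Real.log (1 + u) - 1 ≤ integrand u := by
  have : u / (1 + u) ^ 2 ≤ 1 := by
    rw [div_le_one (by positivity)]
    nlinarith
  rw [integrand]
  linarith

end pointwise

@[fun_prop]
theorem measurable_integrand : Measurable integrand := by
  unfold integrand; fun_prop

variable {ρ : Measure ℝ}

theorem IsSpectralLaw.integrable_of_le (hρ : IsSpectralLaw ρ) {g : ℝ → ℝ} (hg : Measurable g)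
    (A : ℝ) (h : ∀ t, 0 ≤ t → 0 ≤ g t ∧ g t ≤ A * t) : Integrable g ρ := by
  refine (hρ.integrable_id.const_mul A).mono' hg.aestronglyMeasurable ?_
  filter_upwards [hρ.ae_nonneg] with t ht
  rw [Real.norm_eq_abs, abs_of_nonneg (h t ht).1]
  exact (h t ht).2

theorem IsSpectralLaw.integrable_mean (hρ : IsSpectralLaw ρ) {s : ℝ} (hs : 0 ≤ s) :
    Integrable (fun t => t / (1 + s * t) + t / (1 + s * t) ^ 2) ρ :=
  hρ.integrable_of_le (by fun_prop) 2 fun _ ht =>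
    ⟨meanIntegrand_nonneg hs ht, meanIntegrand_le hs ht⟩

theorem IsSpectralLaw.integrable_entropy (hρ : IsSpectralLaw ρ) {s : ℝ} (hs : 0 ≤ s) :
    Integrable (fun t => 1 / 2 * (Real.log (1 + s * t) + s * t / (1 + s * t))) ρ := by
  refine hρ.integrable_of_le (by fun_prop) s fun t ht => ?_
  have h0 : 0 ≤ s * t := by positivity
  have h1 := log_one_add_le h0
  have h2 := div_one_add_le h0
  have h3 : 0 ≤ Real.log (1 + s * t) := Real.log_nonneg (by linarith)
  exact ⟨by positivity, by linarith⟩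

theorem IsSpectralLaw.integrable_integrand (hρ : IsSpectralLaw ρ) {s : ℝ} (hs : 0 ≤ s) :
    Integrable (fun t => integrand (s * t)) ρ :=
  hρ.integrable_of_le (by fun_prop) s fun _ ht =>
    ⟨integrand_nonneg (mul_nonneg hs ht), integrand_le (mul_nonneg hs ht)⟩

/-- A function that is nonnegative and is positive on the positive half line has positive mean. -/
theorem IsSpectralLaw.integral_pos (hρ : IsSpectralLaw ρ) {g : ℝ → ℝ} (hg : Integrable g ρ)
    (h0 : ∀ t, 0 ≤ t → 0 ≤ g t) (h1 : ∀ t, 0 < t → 0 < g t) : 0 < ∫ t, g t ∂ρ := by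
  rw [integral_pos_iff_support_of_nonneg_ae (hρ.ae_nonneg.mono h0) hg]
  exact (pos_iff_ne_zero.2 hρ.measure_Ioi).trans_le (measure_mono fun t ht => (h1 t ht).ne')

theorem IsSpectralLaw.meanFun_pos (hρ : IsSpectralLaw ρ) {s : ℝ} (hs : 0 ≤ s) :
    0 < meanFun ρ s :=
  hρ.integral_pos (hρ.integrable_mean hs) (fun _ ht => meanIntegrand_nonneg hs ht)
    fun t ht => by positivity

theorem IsSpectralLaw.meanFun_anti (hρ : IsSpectralLaw ρ) : AntitoneOn (meanFun ρ) (Set.Ici 0) := by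
  intro s hs s' hs' h
  refine integral_mono_ae (hρ.integrable_mean hs') (hρ.integrable_mean hs) ?_
  filter_upwards [hρ.ae_nonneg] with t ht using meanIntegrand_anti hs h ht

theorem IsSpectralLaw.continuousOn_meanFun (hρ : IsSpectralLaw ρ) :
    ContinuousOn (meanFun ρ) (Set.Ici 0) := by
  refine continuousOn_of_dominated (bound := fun t => 2 * t)
    (fun s _ => Measurable.aestronglyMeasurable (by fun_prop)) (fun s hs => ?_)
    (hρ.integrable_id.const_mul 2) ?_
  · filter_upwards [hρ.ae_nonneg] with t ht
    rw [Real.norm_eq_abs, abs_of_nonneg (meanIntegrand_nonneg hs ht)]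
    exact meanIntegrand_le hs ht
  · filter_upwards [hρ.ae_nonneg] with t ht
    have h1 : ∀ s ∈ Set.Ici (0 : ℝ), 1 + s * t ≠ 0 := fun s hs => by
      have := mul_nonneg (Set.mem_Ici.1 hs) ht
      positivity
    have h2 : ContinuousOn (fun s : ℝ => 1 + s * t) (Set.Ici 0) := by fun_prop
    exact (continuousOn_const.div h2 h1).add
      (continuousOn_const.div (h2.pow 2) fun s hs => pow_ne_zero 2 (h1 s hs))

theorem IsSpectralLaw.entropyFun_tangent (hρ : IsSpectralLaw ρ) {s s' : ℝ} (hs : 0 ≤ s)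
    (hs' : 0 ≤ s') : entropyFun ρ s' ≤ entropyFun ρ s + (s' - s) / 2 * meanFun ρ s := by
  rw [meanFun, ← integral_const_mul, entropyFun, entropyFun,
    ← integral_add (hρ.integrable_entropy hs) ((hρ.integrable_mean hs).const_mul _)]
  refine integral_mono_ae (hρ.integrable_entropy hs')
    ((hρ.integrable_entropy hs).add ((hρ.integrable_mean hs).const_mul _)) ?_
  filter_upwards [hρ.ae_nonneg] with t ht using entropyIntegrand_tangent hs hs' ht

theorem IsSpectralLaw.entropyFun_sub (hρ : IsSpectralLaw ρ) {s : ℝ} (hs : 0 ≤ s) :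
    entropyFun ρ s - s / 2 * meanFun ρ s = gapFun ρ s := by
  rw [meanFun, ← integral_const_mul, entropyFun, gapFun, ← integral_const_mul,
    ← integral_sub (hρ.integrable_entropy hs) ((hρ.integrable_mean hs).const_mul _)]
  refine integral_congr_ae ?_
  filter_upwards [hρ.ae_nonneg] with t ht using entropy_sub_mean_eq hs ht

theorem gapFun_zero : gapFun ρ 0 = 0 := by simp [gapFun, integrand_zero]

theorem IsSpectralLaw.gapFun_strictMonoOn (hρ : IsSpectralLaw ρ) :
    StrictMonoOn (gapFun ρ) (Set.Ici 0) := by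
  intro s hs s' hs' h
  rw [Set.mem_Ici] at hs hs'
  have h1 : 0 < ∫ t, (integrand (s' * t) - integrand (s * t)) ∂ρ := by
    refine hρ.integral_pos ((hρ.integrable_integrand hs').sub (hρ.integrable_integrand hs))
      (fun t ht => sub_nonneg.2 ?_) fun t ht => sub_pos.2 ?_
    · exact integrand_strictMonoOn.monotoneOn (mul_nonneg hs ht) (mul_nonneg hs' ht) (by gcongr)
    · exact integrand_strictMonoOn (mul_nonneg hs ht.le) (mul_nonneg hs' ht.le) (by gcongr)
  rw [integral_sub (hρ.integrable_integrand hs') (hρ.integrable_integrand hs)] at h1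
  unfold gapFun
  linarith

theorem IsSpectralLaw.continuousOn_gapFun (hρ : IsSpectralLaw ρ) (S : ℝ) :
    ContinuousOn (gapFun ρ) (Set.Icc 0 S) := by
  refine ContinuousOn.mul continuousOn_const ?_
  refine continuousOn_of_dominated (bound := fun t => S * t)
    (fun s _ => Measurable.aestronglyMeasurable (by fun_prop)) (fun s hs => ?_)
    (hρ.integrable_id.const_mul S) ?_
  · filter_upwards [hρ.ae_nonneg] with t ht
    have h0 : 0 ≤ s * t := mul_nonneg hs.1 ht
    rw [Real.norm_eq_abs, abs_of_nonneg (integrand_nonneg h0)]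
    exact (integrand_le h0).trans (mul_le_mul_of_nonneg_right hs.2 ht)
  · filter_upwards [hρ.ae_nonneg] with t ht
    have h1 : ∀ s ∈ Set.Icc (0 : ℝ) S, 1 + s * t ≠ 0 := fun s hs => by
      have := mul_nonneg hs.1 ht
      positivity
    have h2 : ContinuousOn (fun s : ℝ => 1 + s * t) (Set.Icc 0 S) := by fun_prop
    have h3 : ContinuousOn (fun s : ℝ => s * t) (Set.Icc 0 S) := by fun_prop
    exact (h2.log h1).sub (h3.div (h2.pow 2) fun s hs => pow_ne_zero 2 (h1 s hs))

/-- Some `[δ, ∞)` has mass `p > 0`, and `integrand (s t)` grows like `log s` uniformly there. -/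
theorem IsSpectralLaw.exists_le_gapFun (hρ : IsSpectralLaw ρ) (α : ℝ) :
    ∃ s, 0 ≤ s ∧ α ≤ gapFun ρ s := by
  have := hρ.isProb
  obtain ⟨n, hn⟩ : ∃ n : ℕ, ρ (Set.Ici (1 / ((n : ℝ) + 1))) ≠ 0 := by
    by_contra! hcon
    refine hρ.measure_Ioi (measure_mono_null (fun t ht => ?_) (measure_iUnion_null hcon))
    obtain ⟨n, hn⟩ := exists_nat_one_div_lt (Set.mem_Ioi.1 ht)
    exact Set.mem_iUnion.2 ⟨n, hn.le⟩
  set δ : ℝ := 1 / ((n : ℝ) + 1) with hδ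
  have hδ0 : 0 < δ := by positivity
  set p := ρ.real (Set.Ici δ) with hp
  have hp0 : 0 < p := ENNReal.toReal_pos hn (measure_ne_top _ _)
  -- Chosen so that `log (1 + s δ) - 1 ≥ 2 |α| / p`; the factor `2` offsets the `1/2` in `gapFun`.
  set s := Real.exp (2 * |α| / p + 1) / δ with hs
  have hs0 : 0 ≤ s := by positivity
  refine ⟨s, hs0, ?_⟩
  have h1 : 2 * |α| / p ≤ integrand (s * δ) := by
    refine le_trans ?_ (log_sub_one_le_integrand (by positivity))
    rw [le_sub_iff_add_le, Real.le_log_iff_exp_le (by positivity), hs, div_mul_cancel₀ _ hδ0.ne']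
    linarith
  have h2 : p * integrand (s * δ) ≤ ∫ t, integrand (s * t) ∂ρ := by
    calc p * integrand (s * δ) = ∫ _t in Set.Ici δ, integrand (s * δ) ∂ρ := by
          rw [setIntegral_const, smul_eq_mul]
      _ ≤ ∫ t in Set.Ici δ, integrand (s * t) ∂ρ := by
          refine setIntegral_mono_on (integrable_const _).integrableOn
            (hρ.integrable_integrand hs0).integrableOn measurableSet_Ici fun t ht => ?_
          have ht' : δ ≤ t := ht
          exact integrand_strictMonoOn.monotoneOn (Set.mem_Ici.2 (by positivity))
            (Set.mem_Ici.2 (mul_nonneg hs0 (hδ0.le.trans ht'))) (by gcongr)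
      _ ≤ _ := setIntegral_le_integral (hρ.integrable_integrand hs0)
          (hρ.ae_nonneg.mono fun t ht => integrand_nonneg (mul_nonneg hs0 ht))
  have h3 : p * (2 * |α| / p) ≤ p * integrand (s * δ) := by gcongr
  rw [mul_div_cancel₀ _ hp0.ne'] at h3
  have := le_abs_self α
  unfold gapFun
  linarith

theorem IsSpectralLaw.exists_gapFun_eq (hρ : IsSpectralLaw ρ) {α : ℝ} (hα : 0 < α) :
    ∃ s, 0 < s ∧ gapFun ρ s = α := by
  obtain ⟨S, hS, hle⟩ := hρ.exists_le_gapFun α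
  obtain ⟨s, hs, hsα⟩ := intermediate_value_Icc hS (hρ.continuousOn_gapFun S)
    (show α ∈ Set.Icc (gapFun ρ 0) (gapFun ρ S) from ⟨by rw [gapFun_zero]; exact hα.le, hle⟩)
  refine ⟨s, lt_of_le_of_ne hs.1 ?_, hsα⟩
  rintro rfl
  rw [gapFun_zero] at hsα
  exact hα.ne hsα

end GaussKDE

namespace GaussKDE

/-! ### The stationarity equations -/

theorem deriv_rate {γ : ℝ} (hγ : 1 ≤ γ) (u : ℝ) : deriv (rate γ) u = u ^ (γ - 1) / 2 := by
  have h : HasDerivAt (rate γ) (γ * u ^ (γ - 1) / (2 * γ)) u :=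
    (Real.hasDerivAt_rpow_const (Or.inr hγ)).div_const _
  rw [h.deriv]
  field_simp

/-- Bernoulli's inequality at `b / a - 1`. At `a = 0` the case `γ = 1` is separate because there `0
^ (γ - 1) = 1`. -/
theorem rpow_tangent {γ : ℝ} (hγ : 1 ≤ γ) {a b : ℝ} (ha : 0 ≤ a) (hb : 0 ≤ b) :
    a ^ γ + γ * a ^ (γ - 1) * (b - a) ≤ b ^ γ := by
  rcases ha.eq_or_lt with rfl | ha
  · rcases hγ.eq_or_lt with rfl | hγ'
    · simp
    · rw [Real.zero_rpow (by linarith), Real.zero_rpow (by linarith)]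
      simpa using Real.rpow_nonneg hb γ
  · have h := one_add_mul_self_le_rpow_one_add (s := b / a - 1) (by
      have : 0 ≤ b / a := by positivity
      linarith) hγ
    rw [add_sub_cancel, Real.div_rpow hb ha.le, le_div_iff₀ (by positivity)] at h
    refine le_trans (le_of_eq ?_) h
    rw [Real.rpow_sub_one ha.ne']
    field_simp

theorem rate_tangent {γ : ℝ} (hγ : 1 ≤ γ) {a b : ℝ} (ha : 0 ≤ a) (hb : 0 ≤ b) :
    rate γ a + a ^ (γ - 1) / 2 * (b - a) ≤ rate γ b := by
  have h := rpow_tangent hγ ha hb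
  have hγ0 : 0 < γ := by linarith
  rw [rate, rate, le_div_iff₀ (by positivity)]
  refine le_trans (le_of_eq ?_) h
  field_simp

theorem rate_nonneg {γ : ℝ} (hγ : 1 ≤ γ) {u : ℝ} (hu : 0 ≤ u) : 0 ≤ rate γ u := by
  unfold rate
  positivity

theorem rpow_le_one_add_pow {q r : ℝ} (hq : 0 ≤ q) (hr : 0 ≤ r) : r ^ q ≤ 1 + r ^ ⌈q⌉₊ := by
  rcases le_total r 1 with h | h
  · have := Real.rpow_le_one hr h hq
    have := pow_nonneg hr ⌈q⌉₊
    linarith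
  · have := Real.rpow_le_rpow_of_exponent_le h (Nat.le_ceil q)
    rw [Real.rpow_natCast] at this
    linarith

@[fun_prop]
theorem measurable_rate (γ : ℝ) : Measurable (rate γ) := by unfold rate; fun_prop

/-- The tangent at `k r`, evaluated at `k r₀`, bounds the increment by the slope at `k r`, and a
natural power dominates the real power `γ - 1`. -/
theorem polyGrowth_rate {γ : ℝ} (hγ : 1 ≤ γ) {k m : ℝ} (hk : 0 ≤ k) (hm : 0 ≤ m) :
    PolyGrowth (fun r => m * rate γ (k * r)) (m * k * (1 + k ^ ⌈γ - 1⌉₊)) ⌈γ - 1⌉₊ where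
  measurable := by fun_prop
  nonneg r hr := mul_nonneg hm (rate_nonneg hγ (mul_nonneg hk hr))
  const_nonneg := by positivity
  sub_le r r₀ hr hr₀ := by
    set n := ⌈γ - 1⌉₊
    have hkr := mul_nonneg hk hr
    have h1 := rate_tangent hγ hkr (mul_nonneg hk hr₀)
    have h2 : (k * r) ^ (γ - 1) ≤ 1 + (k * r) ^ n := rpow_le_one_add_pow (by linarith) hkr
    have h3 : 1 + (k * r) ^ n ≤ (1 + k ^ n) * (1 + r ^ n) := by
      rw [mul_pow]
      have := pow_nonneg hk n
      have := pow_nonneg hr n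
      nlinarith
    have h0 : 0 ≤ (k * r) ^ (γ - 1) := Real.rpow_nonneg hkr _
    have h4 : rate γ (k * r) - rate γ (k * r₀) ≤ k * ((1 + k ^ n) * (1 + r ^ n)) * |r - r₀| := by
      calc rate γ (k * r) - rate γ (k * r₀) ≤ k * ((k * r) ^ (γ - 1) / 2) * (r - r₀) := by
            linear_combination h1
        _ ≤ k * ((k * r) ^ (γ - 1) / 2) * |r - r₀| := by
            gcongr
            exact le_abs_self _
        _ ≤ k * ((1 + k ^ n) * (1 + r ^ n)) * |r - r₀| := by
            gcongr
            linarith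
    have h5 := mul_le_mul_of_nonneg_left h4 hm
    linear_combination h5

/-! ### Reduction to a scalar fixed-point equation and dependence of its root on the coefficient -/

section stationary

variable {ρ : Measure ℝ} {q : ℝ}

/-- The equation `s = κ · meanFun(s) ^ q`, to which the stationarity equations reduce. -/
def IsRoot (ρ : Measure ℝ) (q κ s : ℝ) : Prop := 0 ≤ s ∧ s = κ * meanFun ρ s ^ q

/-- The coefficient `m / (h²) ^ γ` of the reduced stationarity equation. -/
noncomputable def coeff (γ h m : ℝ) : ℝ := m / (h ^ 2) ^ γ

theorem coeff_pos {γ h m : ℝ} (hh : 0 < h) (hm : 0 < m) : 0 < coeff γ h m := by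
  unfold coeff; positivity

theorem isStationary_iff (hρ : IsSpectralLaw ρ) {γ h m l s : ℝ} (hγ : 1 ≤ γ) (hh : 0 < h) :
    IsStationary γ ρ h m l s ↔ l = meanFun ρ s ∧ IsRoot ρ (γ - 1) (coeff γ h m) s := by
  have key : ∀ l : ℝ, 0 ≤ l →
      m / h ^ 2 * deriv (rate γ) (l / h ^ 2) = coeff γ h m * l ^ (γ - 1) / 2 := by
    intro l hl
    rw [deriv_rate hγ, Real.div_rpow hl (by positivity), coeff,
      Real.rpow_sub_one (by positivity) (x := h ^ 2)]
    field_simp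
  constructor
  · intro H
    have hl : l = meanFun ρ s := H.eq_l
    refine ⟨hl, H.lhat_nonneg, ?_⟩
    have h1 := H.eq_lhat
    rw [key l H.l_nonneg, hl] at h1
    linarith
  · rintro ⟨rfl, hs, h1⟩
    have h0 := (hρ.meanFun_pos hs).le
    refine ⟨h0, hs, ?_, rfl⟩
    rw [key _ h0, ← h1]

theorem IsRoot.pos (hρ : IsSpectralLaw ρ) {κ s : ℝ} (hκ : 0 < κ) (h : IsRoot ρ q κ s) :
    0 < s := by
  have := hρ.meanFun_pos h.1
  rw [h.2]
  positivity

theorem IsRoot.lt_of_lt (hρ : IsSpectralLaw ρ) (hq : 0 ≤ q) {κ κ' s s' : ℝ} (hκ' : 0 < κ')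
    (h : IsRoot ρ q κ s) (h' : IsRoot ρ q κ' s') (hlt : κ < κ') : s < s' := by
  by_contra! hle
  have h0 := hρ.meanFun_pos h.1
  have h1 : meanFun ρ s ^ q ≤ meanFun ρ s' ^ q :=
    Real.rpow_le_rpow h0.le (hρ.meanFun_anti h'.1 h.1 hle) hq
  have h2 : 0 < meanFun ρ s ^ q := by positivity
  have h3 : κ * meanFun ρ s ^ q < κ' * meanFun ρ s' ^ q :=
    (mul_lt_mul_of_pos_right hlt h2).trans_le (mul_le_mul_of_nonneg_left h1 hκ'.le)
  rw [← h.2, ← h'.2] at h3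
  linarith

/-- The right side of the fixed-point equation is nonincreasing in `s`, so two roots cannot differ.
-/
theorem IsRoot.unique (hρ : IsSpectralLaw ρ) (hq : 0 ≤ q) {κ s s' : ℝ} (hκ : 0 < κ)
    (h : IsRoot ρ q κ s) (h' : IsRoot ρ q κ s') : s = s' := by
  wlog hle : s ≤ s' generalizing s s'
  · exact (this h' h (le_of_not_ge hle)).symm
  refine le_antisymm hle ?_
  rw [h.2, h'.2]
  exact mul_le_mul_of_nonneg_left (Real.rpow_le_rpow (hρ.meanFun_pos h'.1).le
    (hρ.meanFun_anti h.1 h'.1 hle) hq) hκ.le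

theorem exists_isRoot (hρ : IsSpectralLaw ρ) (hq : 0 ≤ q) {κ : ℝ} (hκ : 0 < κ) :
    ∃ s, IsRoot ρ q κ s := by
  set S := κ * meanFun ρ 0 ^ q with hS
  have h0 := hρ.meanFun_pos le_rfl
  have hS0 : 0 ≤ S := by positivity
  have hc : ContinuousOn (fun s => s - κ * meanFun ρ s ^ q) (Set.Icc 0 S) :=
    continuousOn_id.sub (continuousOn_const.mul
      ((hρ.continuousOn_meanFun.mono Set.Icc_subset_Ici_self).rpow_const fun _ _ => Or.inr hq))
  obtain ⟨s, hs, hs0⟩ := intermediate_value_Icc hS0 hc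
    (show (0 : ℝ) ∈ Set.Icc _ _ from ⟨by linarith, by
      refine sub_nonneg.2 (mul_le_mul_of_nonneg_left ?_ hκ.le)
      exact Real.rpow_le_rpow (hρ.meanFun_pos hS0).le
        (hρ.meanFun_anti Set.self_mem_Ici hS0 hS0) hq⟩)
  exact ⟨s, hs.1, by simp only at hs0; linarith⟩

open Classical in
/-- The solution of `s = κ · meanFun(s) ^ q`. -/
noncomputable def root (ρ : Measure ℝ) (q κ : ℝ) : ℝ :=
  if h : ∃ s, IsRoot ρ q κ s then h.choose else 0

theorem isRoot_root (hρ : IsSpectralLaw ρ) (hq : 0 ≤ q) {κ : ℝ} (hκ : 0 < κ) :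
    IsRoot ρ q κ (root ρ q κ) := by
  have h := exists_isRoot hρ hq hκ
  rw [root, dif_pos h]
  exact h.choose_spec

theorem root_pos (hρ : IsSpectralLaw ρ) (hq : 0 ≤ q) {κ : ℝ} (hκ : 0 < κ) : 0 < root ρ q κ :=
  (isRoot_root hρ hq hκ).pos hρ hκ

/-- The inverse of `κ ↦ root ρ q κ` is explicit, so comparisons of roots become comparisons of
coefficients. -/
theorem isRoot_div (hρ : IsSpectralLaw ρ) {s : ℝ} (hs : 0 < s) :
    IsRoot ρ q (s / meanFun ρ s ^ q) s := by
  have := hρ.meanFun_pos hs.le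
  refine ⟨hs.le, ?_⟩
  field_simp

theorem root_lt_iff (hρ : IsSpectralLaw ρ) (hq : 0 ≤ q) {κ s : ℝ} (hκ : 0 < κ) (hs : 0 < s) :
    root ρ q κ < s ↔ κ < s / meanFun ρ s ^ q := by
  have := hρ.meanFun_pos hs.le
  have hκ' : 0 < s / meanFun ρ s ^ q := by positivity
  have h1 := isRoot_root hρ hq hκ
  have h2 := isRoot_div (q := q) hρ hs
  constructor
  · intro h
    by_contra! hle
    rcases hle.eq_or_lt with heq | hlt
    · rw [heq] at h2
      exact h.ne (h1.unique hρ hq hκ h2)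
    · exact lt_asymm h (h2.lt_of_lt hρ hq hκ h1 hlt)
  · exact h1.lt_of_lt hρ hq hκ' h2

theorem lt_root_iff (hρ : IsSpectralLaw ρ) (hq : 0 ≤ q) {κ s : ℝ} (hκ : 0 < κ) (hs : 0 < s) :
    s < root ρ q κ ↔ s / meanFun ρ s ^ q < κ := by
  have := hρ.meanFun_pos hs.le
  have hκ' : 0 < s / meanFun ρ s ^ q := by positivity
  have h1 := isRoot_root hρ hq hκ
  have h2 := isRoot_div (q := q) hρ hs
  refine ⟨fun h => ?_, h2.lt_of_lt hρ hq hκ h1⟩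
  by_contra! hle
  rcases hle.eq_or_lt with heq | hlt
  · rw [← heq] at h2
    exact h.ne (h2.unique hρ hq hκ h1)
  · exact lt_asymm h (h1.lt_of_lt hρ hq hκ' h2 hlt)

/-- Among positive coefficients, the conditions `a < root` and `root < b` are half lines by the
explicit inverse, hence open. -/
theorem continuousAt_root (hρ : IsSpectralLaw ρ) (hq : 0 ≤ q) {κ : ℝ} (hκ : 0 < κ) :
    ContinuousAt (root ρ q) κ := by
  have h0 := root_pos hρ hq hκ
  refine tendsto_order.2 ⟨fun a ha => ?_, fun b hb => ?_⟩
  · rcases le_or_gt a 0 with h | h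
    · filter_upwards [Ioi_mem_nhds hκ] with κ' hκ' using h.trans_lt (root_pos hρ hq hκ')
    · filter_upwards [Ioi_mem_nhds hκ, Ioi_mem_nhds ((lt_root_iff hρ hq hκ h).1 ha)]
        with κ' h1 h2 using (lt_root_iff hρ hq h1 h).2 h2
  · have hb0 := h0.trans hb
    filter_upwards [Ioi_mem_nhds hκ, Iio_mem_nhds ((root_lt_iff hρ hq hκ hb0).1 hb)]
      with κ' h1 h2 using (root_lt_iff hρ hq h1 hb0).2 h2

end stationary

/-! ### The limiting free entropy -/

/-- The limit of the normalised mean of the log-Laplace functional, up to sign. -/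
noncomputable def freeEntropy (γ : ℝ) (ρ : Measure ℝ) (h m : ℝ) : ℝ :=
  -(m * rate γ ((h ^ 2)⁻¹ * meanFun ρ (root ρ (γ - 1) (coeff γ h m)))) +
    root ρ (γ - 1) (coeff γ h m) * meanFun ρ (root ρ (γ - 1) (coeff γ h m)) / 2 -
    entropyFun ρ (root ρ (γ - 1) (coeff γ h m))

section freeEntropy

variable {ρ : Measure ℝ} {γ h : ℝ}

/-- The root equation says exactly that `s / 2` is the slope of `r ↦ m f_γ(r / h²)` at `r = meanFun
ρ s`; this links the two halves of the argument. -/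
theorem rate_tangent_of_isRoot (hρ : IsSpectralLaw ρ) (hγ : 1 ≤ γ) (hh : 0 < h) {m s : ℝ}
    (hm : 0 < m) (hs : IsRoot ρ (γ - 1) (coeff γ h m) s) {r : ℝ} (hr : 0 ≤ r) :
    m * rate γ ((h ^ 2)⁻¹ * meanFun ρ s) + s / 2 * (r - meanFun ρ s) ≤
      m * rate γ ((h ^ 2)⁻¹ * r) := by
  set l := meanFun ρ s with hl
  have hl0 : 0 < l := hρ.meanFun_pos hs.1
  have h1 := rate_tangent hγ (a := (h ^ 2)⁻¹ * l) (b := (h ^ 2)⁻¹ * r) (by positivity)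
    (by positivity)
  have h2 : s = m * (h ^ 2)⁻¹ * ((h ^ 2)⁻¹ * l) ^ (γ - 1) := by
    rw [hs.2, coeff, Real.mul_rpow (by positivity) hl0.le, Real.inv_rpow (by positivity),
      Real.rpow_sub_one (by positivity) (x := h ^ 2)]
    field_simp
    rfl
  have h3 := mul_le_mul_of_nonneg_left h1 hm.le
  generalize ((h ^ 2)⁻¹ * l) ^ (γ - 1) = z at *
  rw [h2]
  linear_combination h3

/-- Adding the tangent inequality of the rate at the root for `m'` to that of `entropyFun` at the
root for `m` cancels every mixed term. What remains is a supporting line for `freeEntropy`. -/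
theorem freeEntropy_sub_le (hρ : IsSpectralLaw ρ) (hγ : 1 ≤ γ) (hh : 0 < h) {m m' : ℝ}
    (hm : 0 < m) (hm' : 0 < m') :
    freeEntropy γ ρ h m - (m' - m) *
      rate γ ((h ^ 2)⁻¹ * meanFun ρ (root ρ (γ - 1) (coeff γ h m))) ≤ freeEntropy γ ρ h m' := by
  have hq : 0 ≤ γ - 1 := by linarith
  have r1 := isRoot_root hρ hq (coeff_pos (γ := γ) hh hm)
  have r2 := isRoot_root hρ hq (coeff_pos (γ := γ) hh hm')
  unfold freeEntropy
  set s := root ρ (γ - 1) (coeff γ h m)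
  set s' := root ρ (γ - 1) (coeff γ h m')
  have h1 := rate_tangent_of_isRoot hρ hγ hh hm' r2 (hρ.meanFun_pos r1.1).le
  have h2 := hρ.entropyFun_tangent r1.1 r2.1
  linear_combination h1 + h2

/-- Supporting lines at `m` and at `m'` enclose the difference quotient between two slopes, which
merge because the root is continuous in `m`. The root itself is never differentiated. -/
theorem hasDerivAt_freeEntropy (hρ : IsSpectralLaw ρ) (hγ : 1 ≤ γ) (hh : 0 < h) {m : ℝ}
    (hm : 0 < m) :
    HasDerivAt (freeEntropy γ ρ h)
      (-rate γ ((h ^ 2)⁻¹ * meanFun ρ (root ρ (γ - 1) (coeff γ h m)))) m := by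
  have hq : 0 ≤ γ - 1 := by linarith
  set F : ℝ → ℝ := fun m => rate γ ((h ^ 2)⁻¹ * meanFun ρ (root ρ (γ - 1) (coeff γ h m))) with hF
  have hcoeff : ContinuousAt (fun m => coeff γ h m) m := by unfold coeff; fun_prop
  have hroot : ContinuousAt (fun m => root ρ (γ - 1) (coeff γ h m)) m :=
    ContinuousAt.comp (f := fun m => coeff γ h m) (g := root ρ (γ - 1))
      (continuousAt_root hρ hq (coeff_pos hh hm)) hcoeff
  have hmean : ContinuousAt (fun m => meanFun ρ (root ρ (γ - 1) (coeff γ h m))) m :=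
    ContinuousAt.comp (f := fun m => root ρ (γ - 1) (coeff γ h m)) (g := meanFun ρ)
      (hρ.continuousOn_meanFun.continuousAt
        (Ici_mem_nhds (root_pos hρ hq (coeff_pos hh hm)))) hroot
  have hFc : ContinuousAt F m := by
    have : ContinuousAt (fun m => (h ^ 2)⁻¹ * meanFun ρ (root ρ (γ - 1) (coeff γ h m))) m :=
      continuousAt_const.mul hmean
    exact (this.rpow_const (Or.inr (by linarith))).div_const _
  rw [hasDerivAt_iff_isLittleO, Asymptotics.isLittleO_iff]
  intro ε hε
  have hev : ∀ᶠ m' in 𝓝 m, |F m' - F m| < ε := by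
    have := Metric.tendsto_nhds.1 hFc ε hε
    simpa only [Real.dist_eq] using this
  filter_upwards [hev, Ioi_mem_nhds hm] with m' h1 hm'
  have h2 := freeEntropy_sub_le hρ hγ hh hm hm'
  have h3 := freeEntropy_sub_le hρ hγ hh hm' hm
  have h4 : |freeEntropy γ ρ h m' - freeEntropy γ ρ h m - (m' - m) * -F m| ≤
      |(F m' - F m) * (m' - m)| := by
    rw [abs_of_nonneg (by linear_combination h2)]
    refine le_trans ?_ (neg_le_abs _)
    linear_combination h3
  rw [Real.norm_eq_abs, Real.norm_eq_abs, smul_eq_mul]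
  refine h4.trans ?_
  rw [abs_mul]
  gcongr

end freeEntropy

end GaussKDE

namespace GaussKDE

/-! ### The normalisation of the kernel -/

/-- The Stirling sequence decreases from its first value `e / √2`. -/
theorem log_factorial_le {N : ℕ} (hN : N ≠ 0) :
    Real.log N.factorial ≤ 1 + Real.log (2 * N) / 2 + N * Real.log N - N := by
  obtain ⟨n, rfl⟩ := Nat.exists_eq_succ_of_ne_zero hN
  have hpos : (0 : ℝ) < (n.succ : ℕ) := by positivity
  have h1 := Stirling.log_stirlingSeq'_antitone (Nat.zero_le n)
  simp only [Function.comp_apply] at h1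
  rw [Stirling.log_stirlingSeq_formula, Real.log_div hpos.ne' (Real.exp_pos 1).ne', Real.log_exp,
    Nat.succ_eq_one_add 0, add_zero, Stirling.stirlingSeq_one,
    Real.log_div (Real.exp_pos 1).ne' (by positivity), Real.log_exp] at h1
  have : 0 ≤ Real.log (Real.sqrt 2) := Real.log_nonneg (Real.one_le_sqrt.2 one_le_two)
  linarith

/-- Monotonicity places `Γ(x + 1)` between `n!` and `(n + 1)!` for `n = ⌊x⌋`; replacing `n` by `x`
costs only constants and multiples of `log x`. -/
theorem abs_log_Gamma_sub_le {x : ℝ} (hx : 2 ≤ x) :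
    |Real.log (Real.Gamma (x + 1)) - x * Real.log x + x| ≤ 4 + 2 * Real.log x := by
  set n := ⌊x⌋₊ with hn
  have hnx : (n : ℝ) ≤ x := Nat.floor_le (by linarith)
  have hxn : x < n + 1 := Nat.lt_floor_add_one x
  have hn1 : (1 : ℝ) < n := by linarith
  have hn0 : n ≠ 0 := by rintro h0; rw [h0] at hn1; norm_num at hn1
  have hmono := Real.Gamma_strictMonoOn_Ici.monotoneOn
  have hlow : Real.log n.factorial ≤ Real.log (Real.Gamma (x + 1)) := by
    refine Real.log_le_log (by positivity) ?_
    rw [← Real.Gamma_nat_eq_factorial]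
    exact hmono (Set.mem_Ici.2 (by linarith)) (Set.mem_Ici.2 (by linarith)) (by linarith)
  have hup : Real.log (Real.Gamma (x + 1)) ≤ Real.log (n + 1).factorial := by
    refine Real.log_le_log (Real.Gamma_pos_of_pos (by linarith)) ?_
    rw [← Real.Gamma_nat_eq_factorial]
    push_cast
    exact hmono (Set.mem_Ici.2 (by linarith)) (Set.mem_Ici.2 (by linarith)) (by linarith)
  have hlow' := Stirling.le_log_factorial_stirling hn0
  have hup' := log_factorial_le (Nat.succ_ne_zero n)
  have hlogx : 0 ≤ Real.log x := Real.log_nonneg (by linarith)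
  have hlogn : 0 ≤ Real.log n := Real.log_nonneg hn1.le
  have hlogpi : 0 ≤ Real.log (2 * Real.pi) := Real.log_nonneg (by linarith [Real.pi_gt_three])
  have hcmp : ∀ u v : ℝ, 0 < u → 0 < v → Real.log v ≤ Real.log u + (v - u) / u := by
    intro u v hu hv
    have := Real.log_le_sub_one_of_pos (div_pos hv hu)
    rw [Real.log_div hv.ne' hu.ne'] at this
    rw [sub_div, div_self hu.ne']
    linarith
  have hx0 : 0 < x := by linarith
  have hN0 : (0 : ℝ) < n + 1 := by positivity
  have c1 : x * Real.log (n + 1) ≤ x * Real.log x + 1 := by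
    have h := mul_le_mul_of_nonneg_left (hcmp x (n + 1) hx0 hN0) hx0.le
    rw [mul_add, mul_div_cancel₀ _ hx0.ne'] at h
    linarith
  have c2 : Real.log (n + 1) ≤ Real.log x + 1 := by
    have h := hcmp x (n + 1) hx0 hN0
    have : ((n : ℝ) + 1 - x) / x ≤ 1 := by rw [div_le_one hx0]; linarith
    linarith
  have c3 : n * Real.log x ≤ n * Real.log n + 1 := by
    have h := mul_le_mul_of_nonneg_left (hcmp n x (by linarith) hx0) (Nat.cast_nonneg n)
    rw [mul_add, mul_div_cancel₀ _ (by linarith : (n : ℝ) ≠ 0)] at h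
    linarith
  have c4 : (x - n) * Real.log x ≤ Real.log x := mul_le_of_le_one_left hlogx (by linarith)
  have c5 : ((n : ℝ) + 1 - x) * Real.log (n + 1) ≤ Real.log (n + 1) :=
    mul_le_of_le_one_left (Real.log_nonneg (by linarith)) (by linarith)
  have c6 : Real.log (2 * ((n + 1 : ℕ) : ℝ)) ≤ 1 + Real.log (n + 1) := by
    push_cast
    rw [Real.log_mul two_ne_zero hN0.ne']
    linarith [Real.log_two_lt_d9]
  push_cast at hup' c6
  rw [abs_le]
  constructor
  · nlinarith
  · nlinarith

theorem tendsto_log_Gamma : Tendsto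
    (fun x : ℝ => (Real.log (Real.Gamma (x + 1)) - x * Real.log x) / x) atTop (𝓝 (-1)) := by
  have h0 : Tendsto (fun x : ℝ => (4 + 2 * Real.log x) / x) atTop (𝓝 0) := by
    have h1 : Tendsto (fun x : ℝ => Real.log x / x) atTop (𝓝 0) :=
      Real.isLittleO_log_id_atTop.tendsto_div_nhds_zero
    have h2 : Tendsto (fun x : ℝ => 4 / x) atTop (𝓝 0) :=
      tendsto_const_nhds.div_atTop tendsto_id
    have := h2.add (h1.const_mul 2)
    rw [mul_zero, add_zero] at this
    refine this.congr fun x => ?_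
    ring
  rw [tendsto_iff_norm_sub_tendsto_zero]
  refine squeeze_zero' (Eventually.of_forall fun _ => norm_nonneg _) ?_ h0
  filter_upwards [eventually_ge_atTop 2] with x hx
  have hx0 : 0 < x := by linarith
  rw [Real.norm_eq_abs, sub_neg_eq_add, div_add_one hx0.ne', abs_div, abs_of_pos hx0]
  gcongr
  exact abs_log_Gamma_sub_le hx

/-- The normalising integral of the kernel. -/
noncomputable def kernelNorm (γ : ℝ) (d : ℕ) : ℝ :=
  ∫ z : EuclideanSpace ℝ (Fin d), Real.exp (-(d * rate γ (‖z‖ ^ 2 / d)))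

/-- The volume of the unit ball is computed in two ways, once through this integral and once in
closed form. -/
theorem integral_exp_neg_norm_rpow {d : ℕ} (hd : d ≠ 0) {p : ℝ} (hp : 0 < p) :
    ∫ z : EuclideanSpace ℝ (Fin d), Real.exp (-‖z‖ ^ p) =
      Real.Gamma (d / p + 1) * (Real.sqrt Real.pi ^ d / Real.Gamma (d / 2 + 1)) := by
  have : NeZero d := ⟨hd⟩
  have h1 := measure_unitBall_eq_integral_div_gamma
    (volume : Measure (EuclideanSpace ℝ (Fin d))) hp
  rw [EuclideanSpace.volume_ball, ENNReal.ofReal_one, one_pow, one_mul, Fintype.card_fin,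
    finrank_euclideanSpace_fin] at h1
  have hG : 0 < Real.Gamma (d / p + 1) := Real.Gamma_pos_of_pos (by positivity)
  have hG2 : 0 < Real.Gamma ((d : ℝ) / 2 + 1) := Real.Gamma_pos_of_pos (by positivity)
  have hI : 0 ≤ ∫ z : EuclideanSpace ℝ (Fin d), Real.exp (-‖z‖ ^ p) :=
    integral_nonneg fun _ => (Real.exp_pos _).le
  rw [ENNReal.ofReal_eq_ofReal_iff (by positivity) (by positivity)] at h1
  rw [h1, mul_div_cancel₀ _ hG.ne']

/-- The factor by which the kernel is rescaled to a standard form. -/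
noncomputable def kernelScale (γ : ℝ) (d : ℕ) : ℝ := ((d : ℝ) ^ (1 - γ) / (2 * γ)) ^ (1 / (2 * γ))

theorem kernelScale_pos {γ : ℝ} (hγ : 1 ≤ γ) {d : ℕ} (hd : d ≠ 0) : 0 < kernelScale γ d := by
  have : (0 : ℝ) < d := by exact_mod_cast Nat.pos_of_ne_zero hd
  unfold kernelScale
  positivity

/-- `d f_γ(|z|² / d) = d ^ (1 - γ) |z| ^ (2γ) / (2γ)` is a pure power of the norm, so a dilation
removes the prefactor. -/
theorem kernelNorm_eq {γ : ℝ} (hγ : 1 ≤ γ) {d : ℕ} (hd : d ≠ 0) :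
    kernelNorm γ d = (kernelScale γ d ^ d)⁻¹ *
      (Real.Gamma (d / (2 * γ) + 1) * (Real.sqrt Real.pi ^ d / Real.Gamma (d / 2 + 1))) := by
  have hd' : (0 : ℝ) < d := by exact_mod_cast Nat.pos_of_ne_zero hd
  have hk := kernelScale_pos hγ hd
  have key : ∀ z : EuclideanSpace ℝ (Fin d),
      (d : ℝ) * rate γ (‖z‖ ^ 2 / d) = ‖kernelScale γ d • z‖ ^ (2 * γ) := by
    intro z
    rw [norm_smul, Real.norm_eq_abs, abs_of_pos hk, Real.mul_rpow hk.le (norm_nonneg _),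
      kernelScale, ← Real.rpow_mul (by positivity), one_div_mul_cancel (by positivity),
      Real.rpow_one, rate, Real.div_rpow (by positivity) hd'.le, Real.rpow_mul (norm_nonneg _),
      Real.rpow_two, Real.rpow_sub hd', Real.rpow_one]
    ring
  rw [← integral_exp_neg_norm_rpow hd (by positivity), kernelNorm]
  simp only [key]
  rw [Measure.integral_comp_smul (volume : Measure (EuclideanSpace ℝ (Fin d)))
    (fun z => Real.exp (-‖z‖ ^ (2 * γ))) (kernelScale γ d), finrank_euclideanSpace_fin,
    abs_of_pos (by positivity), smul_eq_mul]

theorem kernelNorm_pos {γ : ℝ} (hγ : 1 ≤ γ) {d : ℕ} (hd : d ≠ 0) : 0 < kernelNorm γ d := by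
  have hk := kernelScale_pos hγ hd
  have hG : 0 < Real.Gamma (d / (2 * γ) + 1) := Real.Gamma_pos_of_pos (by positivity)
  have hG2 : 0 < Real.Gamma ((d : ℝ) / 2 + 1) := Real.Gamma_pos_of_pos (by positivity)
  have := Real.pi_pos
  rw [kernelNorm_eq hγ hd]
  positivity

theorem exists_tendsto_log_kernelNorm {γ : ℝ} (hγ : 1 ≤ γ) :
    ∃ z, Tendsto (fun d : ℕ => Real.log (kernelNorm γ d) / d) atTop (𝓝 z) := by
  set ψ : ℝ → ℝ := fun x => (Real.log (Real.Gamma (x + 1)) - x * Real.log x) / x with hψ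
  have hlim : ∀ a : ℝ, 0 < a → Tendsto (fun d : ℕ => ψ (a * d)) atTop (𝓝 (-1)) := fun a ha =>
    tendsto_log_Gamma.comp (tendsto_natCast_atTop_atTop.const_mul_atTop ha)
  set a : ℝ := 1 / (2 * γ) with ha
  have ha0 : 0 < a := by positivity
  have hga : γ * a = 1 / 2 := by rw [ha]; field_simp
  have hG : ∀ b : ℝ, 0 < b → ∀ d : ℕ, 0 < d → Real.log (Real.Gamma (b * d + 1)) =
      d * (b * ψ (b * d) + b * Real.log b + b * Real.log d) := by
    intro b hb d hd
    have hd' : (0 : ℝ) < d := by exact_mod_cast hd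
    rw [hψ]
    simp only
    rw [Real.log_mul hb.ne' hd'.ne']
    field_simp
    ring
  refine ⟨_, Tendsto.congr' ?_ ((((hlim a ha0).const_mul a).sub
    ((hlim (1 / 2) one_half_pos).const_mul (1 / 2))).add_const
    (a * Real.log (2 * γ) + a * Real.log a - 1 / 2 * Real.log (1 / 2) +
      Real.log (Real.sqrt Real.pi)))⟩
  filter_upwards [eventually_gt_atTop 0] with d hd
  have hd' : (0 : ℝ) < d := by exact_mod_cast hd
  have hk := kernelScale_pos hγ hd.ne'
  have hG1 : 0 < Real.Gamma (a * d + 1) := Real.Gamma_pos_of_pos (by positivity)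
  have hG2 : 0 < Real.Gamma ((1 / 2 : ℝ) * d + 1) := Real.Gamma_pos_of_pos (by positivity)
  have hpi := Real.sqrt_pos.2 Real.pi_pos
  have hlk : Real.log (kernelScale γ d) = a * ((1 - γ) * Real.log d - Real.log (2 * γ)) := by
    rw [kernelScale, Real.log_rpow (by positivity), Real.log_div (by positivity) (by positivity),
      Real.log_rpow hd']
  have hZ : Real.log (kernelNorm γ d) = -(d * Real.log (kernelScale γ d)) +
      (Real.log (Real.Gamma (a * d + 1)) + (d * Real.log (Real.sqrt Real.pi) -
        Real.log (Real.Gamma (1 / 2 * d + 1)))) := by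
    rw [kernelNorm_eq hγ hd.ne', show (d : ℝ) / (2 * γ) = a * d by rw [ha]; ring,
      show (d : ℝ) / 2 = 1 / 2 * d by ring, Real.log_mul (by positivity) (by positivity),
      Real.log_mul (by positivity) (by positivity), Real.log_div (by positivity) (by positivity),
      Real.log_inv, Real.log_pow, Real.log_pow]
  rw [hZ, hlk, hG a ha0 d hd, hG (1 / 2) one_half_pos d hd, eq_div_iff hd'.ne']
  -- The `log d` terms of the scale and of the two Gamma factors sum to `(γ a - 1/2) log d = 0`,
  -- which is why a finite limit exists.
  linear_combination (-(d : ℝ) * Real.log d) * hga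

end GaussKDE

namespace GaussKDE

/-! ### Diagonalisation of the data law -/

section diagonal

variable {d : ℕ} {C : Matrix (Fin d) (Fin d) ℝ}

/-- The map sending a standard Gaussian vector to a Gaussian vector with covariance `C`. -/
noncomputable def diagMap (hC : C.PosSemidef) (x : Fin d → ℝ) : EuclideanSpace ℝ (Fin d) :=
  hC.isHermitian.eigenvectorBasis.repr.symm
    (WithLp.toLp 2 fun i => Real.sqrt (hC.isHermitian.eigenvalues i) * x i)

@[fun_prop]
theorem measurable_diagMap (hC : C.PosSemidef) : Measurable (diagMap hC) := by
  unfold diagMap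
  exact (LinearIsometryEquiv.continuous _).measurable.comp (by fun_prop)

theorem norm_sq_diagMap_sub (hC : C.PosSemidef) (x y : Fin d → ℝ) :
    ‖diagMap hC x - diagMap hC y‖ ^ 2 =
      ∑ i, hC.isHermitian.eigenvalues i * (x i - y i) ^ 2 := by
  rw [diagMap, diagMap, ← map_sub, LinearIsometryEquiv.norm_map, EuclideanSpace.real_norm_sq_eq]
  refine Finset.sum_congr rfl fun i _ => ?_
  simp only [PiLp.sub_apply]
  rw [← mul_sub, mul_pow, Real.sq_sqrt (hC.eigenvalues_nonneg i)]

theorem dotProduct_mulVec_eq_sum_eigenvalues (hC : C.PosSemidef) (t : EuclideanSpace ℝ (Fin d)) :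
    t.ofLp ⬝ᵥ C.mulVec t.ofLp =
      ∑ i, hC.isHermitian.eigenvalues i * (hC.isHermitian.eigenvectorBasis.repr t i) ^ 2 := by
  set b := hC.isHermitian.eigenvectorBasis with hb
  have hsymm : C.transpose = C := by
    have := hC.isHermitian.eq
    rwa [Matrix.conjTranspose_eq_transpose_of_trivial] at this
  have h1 : t.ofLp ⬝ᵥ C.mulVec t.ofLp = inner ℝ t (WithLp.toLp 2 (C.mulVec t.ofLp)) := by
    rw [EuclideanSpace.inner_eq_star_dotProduct]
    simp [dotProduct_comm]
  rw [h1, ← b.sum_inner_mul_inner]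
  refine Finset.sum_congr rfl fun i _ => ?_
  have h2 : inner ℝ (b i) (WithLp.toLp 2 (C.mulVec t.ofLp)) =
      hC.isHermitian.eigenvalues i * inner ℝ (b i) t := by
    rw [EuclideanSpace.inner_eq_star_dotProduct, EuclideanSpace.inner_eq_star_dotProduct]
    simp only [star_trivial]
    rw [dotProduct_comm, Matrix.dotProduct_mulVec, ← Matrix.mulVec_transpose, hsymm, hb,
      Matrix.IsHermitian.mulVec_eigenvectorBasis, smul_dotProduct, dotProduct_comm, smul_eq_mul]
  rw [h2, b.repr_apply_apply, real_inner_comm]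
  ring

/-- Characteristic functions agree: in the eigenbasis both are products of one-dimensional Gaussian
ones. A singular `C` is allowed. -/
theorem dataLaw_eq_map (hC : C.PosSemidef) : dataLaw C = (stdPi d).map (diagMap hC) := by
  have hm := measurable_diagMap hC
  have : IsProbabilityMeasure ((stdPi d).map (diagMap hC)) :=
    Measure.isProbabilityMeasure_map hm.aemeasurable
  have : IsProbabilityMeasure (dataLaw C) := by unfold dataLaw; infer_instance
  refine Measure.ext_of_charFun ?_
  funext t
  rw [dataLaw, charFun_multivariateGaussian hC, dotProduct_mulVec_eq_sum_eigenvalues hC, charFun_apply,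
    integral_map hm.aemeasurable (Measurable.aestronglyMeasurable (by fun_prop))]
  set w := hC.isHermitian.eigenvectorBasis.repr t with hw
  set c := hC.isHermitian.eigenvalues with hc
  have hinner : ∀ x, inner ℝ (diagMap hC x) t = ∑ i, inner ℝ (x i) (Real.sqrt (c i) * w i) := by
    intro x
    rw [diagMap, ← LinearIsometryEquiv.inner_map_map hC.isHermitian.eigenvectorBasis.repr,
      LinearIsometryEquiv.apply_symm_apply, PiLp.inner_apply]
    refine Finset.sum_congr rfl fun i _ => ?_
    simp only [RCLike.inner_apply, conj_trivial]
    ring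
  simp_rw [hinner, Complex.ofReal_sum, Finset.sum_mul, Complex.exp_sum]
  rw [stdPi, integral_fintype_prod_eq_prod (fun i (x : ℝ) =>
    Complex.exp (inner ℝ x (Real.sqrt (c i) * w i) * Complex.I))]
  simp_rw [← charFun_apply, charFun_gaussianReal]
  rw [← Complex.exp_sum]
  congr 1
  simp only [inner_zero_right, Complex.ofReal_zero, zero_mul, mul_zero, zero_sub, NNReal.coe_one,
    Complex.ofReal_one, one_mul]
  rw [Finset.sum_neg_distrib, ← Finset.sum_div]
  congr 2
  refine Finset.sum_congr rfl fun i _ => ?_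
  rw [← Complex.ofReal_pow, mul_pow, Real.sq_sqrt (hC.eigenvalues_nonneg i)]

instance : IsProbabilityMeasure (dataLaw C) := by unfold dataLaw; infer_instance

theorem measurable_kernel (γ : ℝ) (d : ℕ) : Measurable (kernel γ d) := by
  unfold kernel; fun_prop

theorem measurable_logMoment (γ h m : ℝ) : Measurable (logMoment γ C h m) := by
  have := measurable_kernel γ d
  unfold logMoment
  refine Real.measurable_log.comp (StronglyMeasurable.measurable ?_)
  refine StronglyMeasurable.integral_prod_right (f := fun x y =>
    kernel γ d (h⁻¹ • (x - y)) ^ m) (Measurable.stronglyMeasurable ?_)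
  unfold Function.uncurry
  fun_prop

theorem logMoment_diagMap {γ : ℝ} (hγ : 1 ≤ γ) (hd : d ≠ 0) (hC : C.PosSemidef) {h m : ℝ}
    (hm : 0 < m) (x : Fin d → ℝ) :
    logMoment γ C h m (diagMap hC x) =
      logLaplace (fun r => m * rate γ ((h ^ 2)⁻¹ * r)) hC.isHermitian.eigenvalues x -
        m * Real.log (kernelNorm γ d) := by
  have hZ := kernelNorm_pos hγ hd
  have hmk := measurable_kernel γ d
  set c := hC.isHermitian.eigenvalues with hc
  have hk : ∀ y, kernel γ d (h⁻¹ • (diagMap hC x - diagMap hC y)) ^ m =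
      (kernelNorm γ d ^ m)⁻¹ *
        Real.exp (-(d * (m * rate γ ((h ^ 2)⁻¹ * sqDist c x y)))) := by
    intro y
    have h1 : ‖h⁻¹ • (diagMap hC x - diagMap hC y)‖ ^ 2 / d = (h ^ 2)⁻¹ * sqDist c x y := by
      rw [norm_smul, mul_pow, norm_sq_diagMap_sub, sqDist, Real.norm_eq_abs, sq_abs, inv_pow]
      ring
    rw [kernel, h1, ← kernelNorm, Real.div_rpow (Real.exp_pos _).le hZ.le, ← Real.exp_mul,
      div_eq_inv_mul]
    congr 2
    ring
  have hg := polyGrowth_rate hγ (k := (h ^ 2)⁻¹) (by positivity) hm.le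
  have hi := integrable_exp_neg_sqDist hg.measurable hg.nonneg
    (c := c) (fun i => hC.eigenvalues_nonneg i) x
  rw [logMoment, dataLaw_eq_map hC, integral_map (measurable_diagMap hC).aemeasurable
    (Measurable.aestronglyMeasurable (by fun_prop))]
  simp only [hk]
  rw [integral_const_mul, Real.log_mul (by positivity) (integral_exp_pos hi).ne', Real.log_inv,
    Real.log_rpow hZ, logLaplace]
  ring

end diagonal

end GaussKDE

namespace GaussKDE

/-! ### The large-dimension limit -/

section limit

variable {c : (d : ℕ) → Fin d → ℝ} {M : ℝ} {ρ : Measure ℝ}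

theorem one_add_mul_pos_of_neg_inv_lt {s t : ℝ} (hs : 0 < s) (ht : -s⁻¹ < t) : 0 < 1 + s * t := by
  have := mul_lt_mul_of_pos_left ht hs
  rw [mul_neg, mul_inv_cancel₀ hs.ne'] at this
  linarith

/-- Positivity of `s` is essential: it makes the statistic bounded on `[0, ∞)`, whereas at `s = 0`
it grows linearly. -/
theorem IsSpectralLimit.tendsto_tiltedMean [IsProbabilityMeasure ρ] (h : IsSpectralLimit c M ρ)
    {s : ℝ} (hs : 0 < s) :
    Tendsto (fun d => tiltedMean s (c d)) atTop (𝓝 (meanFun ρ s)) := by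
  have hlim := h.tendsto_of_sublinear (g := fun t => t / (1 + s * t) + t / (1 + s * t) ^ 2)
    (inv_pos.2 hs) (fun t ht => ?_) (fun ε hε => ⟨2 / s, fun t ht => ?_⟩)
  · refine hlim.2.congr fun d => ?_
    rw [one_div_mul_eq_div]
    rfl
  · have h0 : 1 + s * t ≠ 0 := (one_add_mul_pos_of_neg_inv_lt hs ht).ne'
    have h1 : ContDiffAt ℝ ∞ (fun t : ℝ => 1 + s * t) t := by fun_prop
    exact ((contDiffAt_id.div h1 h0).add
      (contDiffAt_id.div (h1.pow 2) (pow_ne_zero 2 h0))).contDiffWithinAt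
  · have h0 : 0 < 1 + s * t := by positivity
    have h1 : t / (1 + s * t) ≤ 1 / s := by
      rw [div_le_div_iff₀ h0 hs]
      linarith
    have h2 : t / (1 + s * t) ^ 2 ≤ t / (1 + s * t) := by
      have : 1 ≤ 1 + s * t := by linarith [mul_nonneg hs.le ht]
      gcongr
      nlinarith
    have h3 : (2 : ℝ) / s = 1 / s + 1 / s := by ring
    rw [abs_of_nonneg (meanIntegrand_nonneg hs.le ht), h3]
    have := mul_nonneg hε.le ht
    linarith

theorem IsSpectralLimit.tendsto_tiltedEntropy [IsProbabilityMeasure ρ] (h : IsSpectralLimit c M ρ)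
    {s : ℝ} (hs : 0 < s) :
    Tendsto (fun d => tiltedEntropy s (c d)) atTop (𝓝 (entropyFun ρ s)) := by
  have hlim := h.tendsto_of_sublinear
    (g := fun t => 1 / 2 * (Real.log (1 + s * t) + s * t / (1 + s * t)))
    -- The constant comes from `log v ≤ v - 1` at `v = (ε / s)(1 + s t)`, whose linear part is
    -- exactly `ε t`.
    (inv_pos.2 hs) (fun t ht => ?_) (fun ε hε => ⟨ε / s + |Real.log (ε / s)| + 1, fun t ht => ?_⟩)
  · refine hlim.2.congr fun d => ?_
    rw [one_div_mul_eq_div]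
    rfl
  · have h0 : 1 + s * t ≠ 0 := (one_add_mul_pos_of_neg_inv_lt hs ht).ne'
    have h1 : ContDiffAt ℝ ∞ (fun t : ℝ => 1 + s * t) t := by fun_prop
    have h2 : ContDiffAt ℝ ∞ (fun t : ℝ => s * t) t := by fun_prop
    exact (contDiffAt_const.mul ((h1.log h0).add (h2.div h1 h0))).contDiffWithinAt
  · have hst := mul_nonneg hs.le ht
    have h0 : 0 < 1 + s * t := by positivity
    have h1 : s * t / (1 + s * t) ≤ 1 := by rw [div_le_one h0]; linarith
    have h1' : 0 ≤ s * t / (1 + s * t) := by positivity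
    have h2 : 0 ≤ Real.log (1 + s * t) := Real.log_nonneg (by linarith)
    have hκ : 0 < ε / s := by positivity
    have h3 := Real.log_le_sub_one_of_pos (mul_pos hκ h0)
    rw [Real.log_mul hκ.ne' h0.ne'] at h3
    have h4 : ε / s * (1 + s * t) = ε / s + ε * t := by field_simp
    have h5 := neg_abs_le (Real.log (ε / s))
    have h6 : 0 ≤ ε * t := by positivity
    rw [abs_of_nonneg (by positivity)]
    linarith

/-- With the slope fixed at the limiting root for every `d`, the upper and lower bounds have the
same limit because `tiltedMean` tends to `l`. -/
theorem IsSpectralLimit.tendsto_integral_logLaplace [IsProbabilityMeasure ρ]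
    (h : IsSpectralLimit c M ρ) (hρ : IsSpectralLaw ρ) {γ η m : ℝ} (hγ : 1 ≤ γ) (hη : 0 < η)
    (hm : 0 < m) :
    Tendsto (fun d : ℕ => (∫ x, logLaplace (fun r => m * rate γ ((η ^ 2)⁻¹ * r)) (c d) x
      ∂(stdPi d)) / d) atTop (𝓝 (freeEntropy γ ρ η m)) := by
  set Φ : ℝ → ℝ := fun r => m * rate γ ((η ^ 2)⁻¹ * r) with hΦ
  have hq : 0 ≤ γ - 1 := by linarith
  have hroot := isRoot_root hρ hq (coeff_pos (γ := γ) hη hm)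
  set s := root ρ (γ - 1) (coeff γ η m) with hs
  have hs0 : 0 < s := root_pos hρ hq (coeff_pos hη hm)
  set l := meanFun ρ s with hl
  have hg := polyGrowth_rate hγ (k := (η ^ 2)⁻¹) (by positivity) hm.le
  have htan : ∀ r, 0 ≤ r → Φ l + s / 2 * (r - l) ≤ Φ r := fun r hr =>
    rate_tangent_of_isRoot hρ hγ hη hm hroot hr
  have hbounds := fun {d : ℕ} (hd : d ≠ 0) =>
    integral_logLaplace_bounds hg hd hs0 htan (c := c d) (h.nonneg d)
  have hE := h.tendsto_tiltedEntropy hs0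
  have hL := h.tendsto_tiltedMean hs0
  have hΦc : Continuous Φ := by
    refine continuous_const.mul (Continuous.div_const ?_ _)
    exact (continuous_const.mul continuous_id).rpow_const fun _ => Or.inr (by linarith)
  have hroot0 : Tendsto (fun d : ℕ => m * (η ^ 2)⁻¹ * (1 + ((η ^ 2)⁻¹) ^ ⌈γ - 1⌉₊) *
      fluctConst s ⌈γ - 1⌉₊ / Real.sqrt d) atTop (𝓝 0) :=
    tendsto_const_nhds.div_atTop (Real.tendsto_sqrt_atTop.comp tendsto_natCast_atTop_atTop)
  have hval : freeEntropy γ ρ η m = -Φ l + s * l / 2 - entropyFun ρ s := rfl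
  rw [hval]
  refine tendsto_of_tendsto_of_tendsto_of_le_of_le'
    (g := fun d : ℕ => s / 2 * tiltedMean s (c d) - Φ (tiltedMean s (c d)) -
      m * (η ^ 2)⁻¹ * (1 + ((η ^ 2)⁻¹) ^ ⌈γ - 1⌉₊) * fluctConst s ⌈γ - 1⌉₊ / Real.sqrt d -
      tiltedEntropy s (c d))
    (h := fun d : ℕ => -Φ l + s * l / 2 - tiltedEntropy s (c d)) ?_ (hE.const_sub _) ?_ ?_
  · have h1 := (((hL.const_mul (s / 2)).sub ((hΦc.tendsto l).comp hL)).sub hroot0).sub hE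
    refine Tendsto.congr (fun d => rfl) (h1.trans (le_of_eq ?_))
    congr 1
    ring
  · filter_upwards [eventually_ne_atTop 0] with d hd using (hbounds hd).2.2
  · filter_upwards [eventually_ne_atTop 0] with d hd using (hbounds hd).2.1

end limit

/-! ### Limit of the free entropy, its derivative at `m = 1`, and the threshold bandwidth -/

section gMean

variable {C : (d : ℕ) → Matrix (Fin d) (Fin d) ℝ} {hC : ∀ d, (C d).PosSemidef} {M : ℝ}
  {ρ : Measure ℝ} {γ h m : ℝ}

theorem isSpectralLimit_of_spectrumTendsto (hbound : ∀ d : ℕ, (C d).trace ≤ M * d)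
    (hspec : SpectrumTendsto C hC ρ) :
    IsSpectralLimit (fun d => (hC d).isHermitian.eigenvalues) M ρ where
  nonneg d i := (hC d).eigenvalues_nonneg i
  sum_le d := by
    have := (hC d).isHermitian.trace_eq_sum_eigenvalues
    simp only [RCLike.ofReal_real_eq_id, id_eq] at this
    rw [← this]
    exact hbound d
  tendsto := hspec

theorem integrable_logLaplace_rate {d : ℕ} (hd : d ≠ 0) {c : Fin d → ℝ} (hc : ∀ i, 0 ≤ c i)
    (hγ : 1 ≤ γ) (hh : 0 < h) (hm : 0 < m) :
    Integrable (logLaplace (fun r => m * rate γ ((h ^ 2)⁻¹ * r)) c) (stdPi d) := by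
  set k := (h ^ 2)⁻¹ with hk
  have hk0 : 0 < k := by positivity
  -- For integrability any tangent of positive slope will do; the one at `l = 1` is taken.
  refine (integral_logLaplace_bounds (polyGrowth_rate hγ hk0.le hm.le) hd
    (s := m * k * k ^ (γ - 1)) (l := 1) (by positivity) (fun r hr => ?_) hc).1
  have h1 := mul_le_mul_of_nonneg_left
    (rate_tangent hγ (a := k * 1) (b := k * r) (by positivity) (by positivity)) hm.le
  rw [mul_one] at h1 ⊢
  linear_combination h1

theorem integrable_logMoment {d : ℕ} {C : Matrix (Fin d) (Fin d) ℝ} (hC : C.PosSemidef)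
    (hγ : 1 ≤ γ) (hh : 0 < h) (hm : 0 < m) :
    Integrable (logMoment γ C h m) (dataLaw C) := by
  rcases eq_or_ne d 0 with rfl | hd
  · exact Integrable.of_finite
  · rw [dataLaw_eq_map hC, integrable_map_measure
      (measurable_logMoment γ h m).aestronglyMeasurable (measurable_diagMap hC).aemeasurable]
    refine ((integrable_logLaplace_rate hd (fun i => hC.eigenvalues_nonneg i) hγ hh hm).sub
      (integrable_const (m * Real.log (kernelNorm γ d)))).congr (Eventually.of_forall fun x => ?_)
    exact (logMoment_diagMap hγ hd hC hm x).symm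

theorem gMean_eq {d : ℕ} {C : Matrix (Fin d) (Fin d) ℝ} (hC : C.PosSemidef) (hd : d ≠ 0)
    (hγ : 1 ≤ γ) (hh : 0 < h) (hm : 0 < m) :
    gMean γ C h m = (∫ x, logLaplace (fun r => m * rate γ ((h ^ 2)⁻¹ * r))
      hC.isHermitian.eigenvalues x ∂(stdPi d)) / d - m * (Real.log (kernelNorm γ d) / d) -
        m * Real.log h := by
  rw [gMean, dataLaw_eq_map hC, integral_map (measurable_diagMap hC).aemeasurable
    (measurable_logMoment γ h m).aestronglyMeasurable]
  simp only [logMoment_diagMap hγ hd hC hm]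
  rw [integral_sub (integrable_logLaplace_rate hd (fun i => hC.eigenvalues_nonneg i) hγ hh hm)
    (integrable_const _)]
  simp only [integral_const, probReal_univ, smul_eq_mul]
  ring

/-- The limit of `gMean`, up to the contribution of the normalisation of the kernel. -/
theorem exists_tendsto_gMean (hlim : IsSpectralLimit (fun d => (hC d).isHermitian.eigenvalues) M ρ)
    (hρ : IsSpectralLaw ρ) (hγ : 1 ≤ γ) :
    ∃ z, ∀ h m, 0 < h → 0 < m → Tendsto (fun d => gMean γ (C d) h m) atTop
      (𝓝 (freeEntropy γ ρ h m - m * z - m * Real.log h)) := by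
  have := hρ.isProb
  obtain ⟨z, hz⟩ := exists_tendsto_log_kernelNorm hγ
  refine ⟨z, fun h m hh hm => ?_⟩
  refine (((hlim.tendsto_integral_logLaplace hρ hγ hh hm).sub (hz.const_mul m)).sub_const
    (m * Real.log h)).congr' ?_
  filter_upwards [eventually_ne_atTop 0] with d hd
  exact (gMean_eq (hC d) hd hγ hh hm).symm

/-- The derivative at `m = 1` of the replica free entropy. -/
theorem hasDerivAt_replicaFreeEntropy
    (hlim : IsSpectralLimit (fun d => (hC d).isHermitian.eigenvalues) M ρ)
    (hρ : IsSpectralLaw ρ) (hγ : 1 ≤ γ) (hh : 0 < h) (α : ℝ) :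
    HasDerivAt (fun m => replicaFreeEntropy γ C α h m)
      (-α + gapFun ρ (root ρ (γ - 1) (coeff γ h 1))) 1 := by
  obtain ⟨z, hz⟩ := exists_tendsto_gMean (hC := hC) hlim hρ hγ
  have hG := hasDerivAt_freeEntropy hρ hγ hh one_pos
  have hinv : HasDerivAt (fun m : ℝ => 1 / m) (-1) 1 := by
    simpa [one_div] using hasDerivAt_inv (one_ne_zero (α := ℝ))
  have hid := hasDerivAt_id (1 : ℝ)
  have hroot := isRoot_root hρ (q := γ - 1) (by linarith) (coeff_pos (γ := γ) hh one_pos)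
  have hgap := hρ.entropyFun_sub hroot.1
  have hmain : HasDerivAt (fun m : ℝ => (1 / m - 1) * α + 1 / m * (freeEntropy γ ρ h m - m * z -
      m * Real.log h)) (-α + gapFun ρ (root ρ (γ - 1) (coeff γ h 1))) 1 := by
    have := ((hinv.sub_const 1).mul_const α).add
      (hinv.mul ((hG.sub (hid.mul_const z)).sub (hid.mul_const (Real.log h))))
    convert! this using 1
    simp only [Pi.sub_apply, id]
    -- The value at `1` is `-α + F'(1) - F(1)` with `F = freeEntropy`: the rate term cancels and
    -- `entropyFun - s l / 2` is left. The contributions of `z` and `log h` are linear in `m`, hence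
    -- constant after division by `m`.
    rw [← hgap, freeEntropy]
    ring
  refine hmain.congr_of_eventuallyEq ?_
  filter_upwards [Ioi_mem_nhds (zero_lt_one (α := ℝ))] with m hm
  have hm' : m ≠ 0 := ne_of_gt hm
  rw [replicaFreeEntropy, gBar, (hz h m hh hm).limUnder_eq, sub_div, div_self hm']

/-- The sign of `α` minus the gap functional changes exactly once along the bandwidth. -/
theorem exists_threshold (hρ : IsSpectralLaw ρ) (hγ : 1 ≤ γ) {α : ℝ} (hα : 0 < α) :
    ∃ h₀, 0 < h₀ ∧ gapFun ρ (root ρ (γ - 1) (coeff γ h₀ 1)) = α ∧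
      (∀ h, 0 < h → h < h₀ → α < gapFun ρ (root ρ (γ - 1) (coeff γ h 1))) ∧
      ∀ h, h₀ < h → gapFun ρ (root ρ (γ - 1) (coeff γ h 1)) < α := by
  have hq : 0 ≤ γ - 1 := by linarith
  obtain ⟨s, hs, hsα⟩ := hρ.exists_gapFun_eq hα
  have hmean := hρ.meanFun_pos hs.le
  set κ := s / meanFun ρ s ^ (γ - 1) with hκ
  have hκ0 : 0 < κ := by positivity
  have hγ0 : 0 < γ := by linarith
  -- Solves `1 / h₀ ^ (2γ) = κ`, where `κ` is the coefficient whose root is the level `s` with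
  -- `gapFun ρ s = α`.
  set h₀ := Real.sqrt ((κ⁻¹) ^ (1 / γ)) with hh₀
  have hpos : 0 < h₀ := Real.sqrt_pos.2 (by positivity)
  have hcoeff : coeff γ h₀ 1 = κ := by
    rw [coeff, hh₀, Real.sq_sqrt (by positivity), ← Real.rpow_mul (by positivity),
      one_div_mul_cancel hγ0.ne', Real.rpow_one, one_div, inv_inv]
  have hroot : root ρ (γ - 1) κ = s :=
    (isRoot_root hρ hq hκ0).unique hρ hq hκ0 (isRoot_div hρ hs)
  have hanti : ∀ a b : ℝ, 0 < a → a < b → coeff γ b 1 < coeff γ a 1 := fun a b ha hab =>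
    one_div_lt_one_div_of_lt (by positivity) (Real.rpow_lt_rpow (by positivity)
      (pow_lt_pow_left₀ hab ha.le two_ne_zero) hγ0)
  refine ⟨h₀, hpos, by rw [hcoeff, hroot, hsα], fun h hh hlt => ?_, fun h hlt => ?_⟩
  · have h1 : s < root ρ (γ - 1) (coeff γ h 1) :=
      (lt_root_iff hρ hq (coeff_pos hh one_pos) hs).2 (by
        rw [← hκ, ← hcoeff]
        exact hanti h h₀ hh hlt)
    rw [← hsα]
    exact hρ.gapFun_strictMonoOn hs.le (hs.trans h1).le h1
  · have hh := hpos.trans hlt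
    have h1 : root ρ (γ - 1) (coeff γ h 1) < s :=
      (root_lt_iff hρ hq (coeff_pos hh one_pos) hs).2 (by
        rw [← hκ, ← hcoeff]
        exact hanti h₀ h hpos hlt)
    rw [← hsα]
    exact hρ.gapFun_strictMonoOn (root_pos hρ hq (coeff_pos hh one_pos)).le hs.le h1

end gMean

end GaussKDE

/-! ### Assembly of the main statement -/

theorem proposition11 (γ : ℝ) (hγ : 1 ≤ γ)
    (C : (d : ℕ) → Matrix (Fin d) (Fin d) ℝ) (hC : ∀ d, (C d).PosSemidef)
    (hbound : ∃ M : ℝ, ∀ d : ℕ, (C d).trace ≤ M * d)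
    (ρC : Measure ℝ) [IsProbabilityMeasure ρC]
    (hspec : GaussKDE.SpectrumTendsto C hC ρC) (hρC : ρC ≠ Measure.dirac 0) :
    -- the replica free entropy is well defined
    (∀ h m : ℝ, 0 < h → 0 < m →
      (∀ d : ℕ, Integrable (GaussKDE.logMoment γ (C d) h m) (GaussKDE.dataLaw (C d))) ∧
      Tendsto (fun d : ℕ => GaussKDE.gMean γ (C d) h m) atTop (𝓝 (GaussKDE.gBar γ C h m))) ∧
    -- the stationarity equations at `m = 1` have a unique solution
    (∀ h : ℝ, 0 < h → ∃! p : ℝ × ℝ, GaussKDE.IsStationary γ ρC h 1 p.1 p.2) ∧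
    -- the formula for `D(α,h)`
    (∀ h l lhat : ℝ, 0 < h → GaussKDE.IsStationary γ ρC h 1 l lhat →
      Integrable (fun t => GaussKDE.integrand (lhat * t)) ρC ∧
      ∀ α : ℝ, 0 < α →
        DifferentiableAt ℝ (fun m => GaussKDE.replicaFreeEntropy γ C α h m) 1 ∧
        GaussKDE.glassD γ C α h = -α + 1 / 2 * ∫ t, GaussKDE.integrand (lhat * t) ∂ρC) ∧
    -- the critical line `h_G(α)` is the unique root of `D(α,·)`
    (∀ α : ℝ, 0 < α → ∃ hG : ℝ, 0 < hG ∧ GaussKDE.glassD γ C α hG = 0 ∧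
      (∀ h : ℝ, 0 < h → GaussKDE.glassD γ C α h = 0 → h = hG) ∧
      (∀ h : ℝ, 0 < h → h < hG → 0 < GaussKDE.glassD γ C α h) ∧
      (∀ h : ℝ, hG < h → GaussKDE.glassD γ C α h < 0)) ∧
    -- the Gaussian kernel
    (γ = 1 →
      (∀ h l lhat : ℝ, 0 < h → GaussKDE.IsStationary γ ρC h 1 l lhat → lhat = 1 / h ^ 2) ∧
      (∀ α h : ℝ, 0 < α → 0 < h → (GaussKDE.glassD γ C α h = 0 ↔
        α = 1 / 2 * ∫ t, (Real.log (1 + t / h ^ 2) -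
          (t / h ^ 2) / (1 + t / h ^ 2) ^ 2) ∂ρC))) := by
  obtain ⟨M, hM⟩ := hbound
  have hlim := GaussKDE.isSpectralLimit_of_spectrumTendsto hM hspec
  have hρ : GaussKDE.IsSpectralLaw ρC := ⟨inferInstance, hlim.ae_nonneg, hlim.integrable_id, hρC⟩
  have hq : 0 ≤ γ - 1 := by linarith
  obtain ⟨z, hz⟩ := GaussKDE.exists_tendsto_gMean (hC := hC) hlim hρ hγ
  have hroot : ∀ h : ℝ, 0 < h → GaussKDE.IsRoot ρC (γ - 1) (GaussKDE.coeff γ h 1)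
      (GaussKDE.root ρC (γ - 1) (GaussKDE.coeff γ h 1)) := fun h hh =>
    GaussKDE.isRoot_root hρ hq (GaussKDE.coeff_pos hh one_pos)
  have huniq : ∀ h l s : ℝ, 0 < h → GaussKDE.IsStationary γ ρC h 1 l s →
      s = GaussKDE.root ρC (γ - 1) (GaussKDE.coeff γ h 1) := fun h l s hh hs =>
    ((GaussKDE.isStationary_iff hρ hγ hh).1 hs).2.unique hρ hq
      (GaussKDE.coeff_pos hh one_pos) (hroot h hh)
  have hderiv := fun (α : ℝ) {h : ℝ} (hh : 0 < h) =>
    GaussKDE.hasDerivAt_replicaFreeEntropy (hC := hC) hlim hρ hγ hh α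
  have hD : ∀ α h : ℝ, 0 < h → GaussKDE.glassD γ C α h =
      -α + GaussKDE.gapFun ρC (GaussKDE.root ρC (γ - 1) (GaussKDE.coeff γ h 1)) :=
    fun α h hh => (hderiv α hh).deriv
  refine ⟨fun h m hh hm => ⟨fun d => GaussKDE.integrable_logMoment (hC d) hγ hh hm, ?_⟩,
    fun h hh => ?_, fun h l lhat hh hs => ?_, fun α hα => ?_, ?_⟩
  · rw [GaussKDE.gBar, (hz h m hh hm).limUnder_eq]
    exact hz h m hh hm
  · refine ⟨(GaussKDE.meanFun ρC (GaussKDE.root ρC (γ - 1) (GaussKDE.coeff γ h 1)),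
      GaussKDE.root ρC (γ - 1) (GaussKDE.coeff γ h 1)),
      (GaussKDE.isStationary_iff hρ hγ hh).2 ⟨rfl, hroot h hh⟩, fun p hp => ?_⟩
    have h2 := huniq h p.1 p.2 hh hp
    have h1 := ((GaussKDE.isStationary_iff hρ hγ hh).1 hp).1
    refine Prod.ext ?_ h2
    rw [h1, h2]
  · refine ⟨hρ.integrable_integrand hs.lhat_nonneg, fun α _ => ?_⟩
    have h2 := huniq h l lhat hh hs
    refine ⟨(hderiv α hh).differentiableAt, ?_⟩
    rw [hD α h hh, ← h2]
    rfl
  · obtain ⟨h₀, hpos, heq, hlt, hgt⟩ := GaussKDE.exists_threshold hρ hγ hα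
    refine ⟨h₀, hpos, by rw [hD α h₀ hpos, heq]; ring, fun h hh h0 => ?_, fun h hh hh' => ?_,
      fun h hh => ?_⟩
    · rw [hD α h hh] at h0
      rcases lt_trichotomy h h₀ with h1 | h1 | h1
      · linarith [hlt h hh h1]
      · exact h1
      · linarith [hgt h h1]
    · rw [hD α h hh]
      linarith [hlt h hh hh']
    · rw [hD α h (hpos.trans hh)]
      linarith [hgt h hh]
  · rintro rfl
    -- For `γ = 1` the exponent `γ - 1` vanishes, so the fixed-point equation no longer involves
    -- `meanFun` and its root is the coefficient itself.
    have hval : ∀ h : ℝ, 0 < h →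
        GaussKDE.root ρC (1 - 1) (GaussKDE.coeff 1 h 1) = 1 / h ^ 2 := fun h hh => by
      rw [(hroot h hh).2]
      simp [GaussKDE.coeff]
    refine ⟨fun h l lhat hh hs => by rw [huniq h l lhat hh hs, hval h hh],
      fun α h _ hh => ?_⟩
    have hint : GaussKDE.gapFun ρC (1 / h ^ 2) = 1 / 2 * ∫ t, (Real.log (1 + t / h ^ 2) -
        (t / h ^ 2) / (1 + t / h ^ 2) ^ 2) ∂ρC := by
      simp only [GaussKDE.gapFun, GaussKDE.integrand, one_div_mul_eq_div]
    rw [hD α h hh, hval h hh, ← hint]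
    constructor <;> intro h0 <;> linarith
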